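/- All spaces below carry their usual Polish (or subspace) topologies. For a countable language $L$, the set of $L$-structures with universe $\omega$ carries the logic topology; for an $L_{\omega_1\omega}$-sentence $\Psi$, or a theory $T$, $\mathrm{Mod}(\Psi)$, $\mathrm{Mod}(T)$ denote the subspaces of models with universe $\omega$. An equivalence relation $E$ on $Y$ *Borel reduces* to an equivalence relation $F$ on $Z$, written $(Y,E)\le_B(Z,F)$, if there is a Borel map $f:Y\to Z$ such that $y\,E\,y'\iff f(y)\,F\,f(y')$ for all $y,y'\in Y$; they are *Borel bireducible* if each Borel reduces to the other. $T$ is *Borel complete* if $(\mathrm{Mod}(\Psi),\cong)\le_B(\mathrm{Mod}(T),\cong)$ for every sentence $\Psi$ of $L'_{\omega_1\omega}$ and every countable language $L'$. Let $\mathrm{TK}$ be the following many-sorted first-order theory, with disjoint sorts $U$, $V_i$, $C_i$ ($i\in\omega$), which exhaust every model, and unary function symbols $S_i:V_i\to V_i$, $\pi^0_i:V_i\to C_i$, $\pi^1_i:V_i\to U$, $\tau_{i+1}:C_{i+1}\to C_i$ ($i\in\omega$). Its axioms say: - $U$ and every $V_i$ are infinite, and $|C_i|=2^i$; - $\tau_{i+1}$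 is surjective and $|\tau_{i+1}^{-1}(c)|=2$ for all $c\in C_i$; - for all $c\in C_i$ and $u\in U$ there is $x\in V_i$ with $\pi^0_i(x)=c$ and $\pi^1_i(x)=u$; - $S_i$ is a bijection of $V_i$ without cycles (that is, $S_i^n(x)\neq x$ for all $n\ge 1$ and $x\in V_i$), with $\pi^0_i\circ S_i=\pi^0_i$ and $\pi^1_i\circ S_i=\pi^1_i$. Let $X=\omega^{2^{<\omega}}$ be the space of all colorings $c:2^{<\omega}\to\omega$, and let $G=\mathrm{Aut}(2^{<\omega},\le)$ be the automorphism group of the tree of finite binary sequences ordered by initial segment, acting on $X$ by $(g\cdot c)(s)=c(g^{-1}s)$. Then $G$ acts diagonally on $X^\omega$, $S_\infty=\mathrm{Sym}(\omega)$ acts on $X^\omega$ by permuting the entries of sequences, and these actions commute; let $E_{G\times S_\infty}$ be the orbit equivalence relation of the resulting action of $G\times S_\infty$ on $X^\omega$. Let $\mathrm{Graphs}$ be the space of symmetric irreflexive graphs with vertex set $\omega$. **Theorem.** 1. $(\mathrm{Graphs},\cong)\le_B(X^\omega,E_{G\times S_\infty})$. 2. $(\mathrm{Mod}(\mathrm{TK}),\cong)$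 and $(X^\omega,E_{G\times S_\infty})$ are Borel bireducible. 3. $\mathrm{TK}$ is Borel complete. -/

import Mathlib

/-! ### Borel reducibility -/

/-- `E` Borel reduces to `F`: there is a Borel map `f` with `x E y ↔ f x F f y`. -/
def BorelReducible {α β : Type*} [TopologicalSpace α] [TopologicalSpace β]
    (E : α → α → Prop) (F : β → β → Prop) : Prop :=
  ∃ f : α → β, @Measurable α β (borel α) (borel β) f ∧ ∀ x y, E x y ↔ F (f x) (f y)

/-- `E` and `F` are Borel bireducible. -/
def BorelBireducible {α β : Type*} [TopologicalSpace α] [TopologicalSpace β]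
    (E : α → α → Prop) (F : β → β → Prop) : Prop :=
  BorelReducible E F ∧ BorelReducible F E

/-! ### The space of countable structures -/

/-- The logic topology on the set of `L`-structures with universe `ℕ`: the sets
`{M | f^M(v) = k}`, `{M | R^M(v)}` and `{M | ¬ R^M(v)}` form a subbasis. -/
instance logicTopology (L : FirstOrder.Language) : TopologicalSpace (L.Structure ℕ) :=
  TopologicalSpace.generateFrom
    ({A | ∃ (n : ℕ) (f : L.Functions n) (v : Fin n → ℕ) (k : ℕ),
        A = {M : L.Structure ℕ | M.funMap f v = k}} ∪
     {A | ∃ (n : ℕ) (R : L.Relations n) (v : Fin n → ℕ),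
        A = {M : L.Structure ℕ | M.RelMap R v} ∨ A = {M : L.Structure ℕ | ¬ M.RelMap R v}})

/-- The isomorphism relation on a class `K` of `L`-structures with universe `ℕ`. -/
def IsoOn {L : FirstOrder.Language} (K : Set (L.Structure ℕ)) (M N : K) : Prop :=
  Nonempty (@FirstOrder.Language.Equiv L ℕ ℕ M.1 N.1)

/-! ### The infinitary logic `L_{ω₁ω}` -/

/-- Formulas of `L_{ω₁ω}` with free variables among `x₀, …, x_{n-1}`. -/
inductive InfFormula (L : FirstOrder.Language) : ℕ → Type _
  | falsum {n : ℕ} : InfFormula L n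
  | equal {n : ℕ} (t₁ t₂ : L.Term (Fin n)) : InfFormula L n
  | rel {n k : ℕ} (R : L.Relations k) (ts : Fin k → L.Term (Fin n)) : InfFormula L n
  | neg {n : ℕ} (φ : InfFormula L n) : InfFormula L n
  | conj {n : ℕ} (φ : ℕ → InfFormula L n) : InfFormula L n
  | all {n : ℕ} (φ : InfFormula L (n + 1)) : InfFormula L n

/-- Satisfaction of a formula of `L_{ω₁ω}` in a structure under an assignment. -/
def InfFormula.Realize {L : FirstOrder.Language} {M : Type*} [L.Structure M] :
    {n : ℕ} → InfFormula L n → (Fin n → M) → Prop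
  | _, .falsum, _ => False
  | _, .equal t₁ t₂, v => t₁.realize v = t₂.realize v
  | _, .rel R ts, v => FirstOrder.Language.Structure.RelMap R (fun i => (ts i).realize v)
  | _, .neg φ, v => ¬ φ.Realize v
  | _, .conj φ, v => ∀ i, (φ i).Realize v
  | _, .all φ, v => ∀ x : M, φ.Realize (Fin.snoc v x)

/-- `Mod(Ψ)`: the models with universe `ℕ` of an `L_{ω₁ω}`-sentence `Ψ`. -/
def InfMod {L : FirstOrder.Language} (Ψ : InfFormula L 0) : Set (L.Structure ℕ) :=
  {M | @InfFormula.Realize L ℕ M 0 Ψ Fin.elim0}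

/-- A class `K` of structures with universe `ℕ` is Borel complete if `(Mod(Ψ), ≅)` Borel reduces
to `(K, ≅)` for every sentence `Ψ` of `L'_{ω₁ω}`, for every countable language `L'`. -/
def BorelComplete {L : FirstOrder.Language} (K : Set (L.Structure ℕ)) : Prop :=
  ∀ (L' : FirstOrder.Language.{0, 0}) [Countable L'.Symbols] (Ψ : InfFormula L' 0),
    BorelReducible (IsoOn (InfMod Ψ)) (IsoOn K)

/-! ### Graphs -/

/-- The class of (symmetric, irreflexive) graphs with vertex set `ℕ`. -/
def GraphMod : Set (FirstOrder.Language.graph.Structure ℕ) :=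
  {M | @FirstOrder.Language.Theory.Model FirstOrder.Language.graph ℕ M
    FirstOrder.Language.Theory.simpleGraph}

/-! ### The theory `TK` -/

/-- Function symbols of `TK`: `S i : V i → V i`, `pr0 i : V i → C i`, `pr1 i : V i → U`
and `tau i : C (i + 1) → C i` (usually written `S_i`, `π⁰_i`, `π¹_i`, `τ_{i+1}`). -/
inductive TKFun : ℕ → Type
  | S (i : ℕ) : TKFun 1
  | pr0 (i : ℕ) : TKFun 1
  | pr1 (i : ℕ) : TKFun 1
  | tau (i : ℕ) : TKFun 1

/-- The names of the sorts of `TK`, as unary relation symbols. -/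
inductive TKRel : ℕ → Type
  | U : TKRel 1
  | V (i : ℕ) : TKRel 1
  | C (i : ℕ) : TKRel 1

/-- The language of `TK`. The sorts are unary predicates that partition the universe. -/
def TKLang : FirstOrder.Language := ⟨TKFun, TKRel⟩

namespace TK

variable (M : Type*) [str : TKLang.Structure M]

/-- The elements of `M` of a given sort. -/
def sort (s : TKRel 1) : Set M := {x | str.RelMap (n := 1) s ![x]}

/-- The interpretation in `M` of a function symbol. -/
def app (f : TKFun 1) (x : M) : M := str.funMap (n := 1) f ![x]

/-- The sort on which a function symbol is defined. -/
def dom : TKFun 1 → TKRel 1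
  | .S i => .V i
  | .pr0 i => .V i
  | .pr1 i => .V i
  | .tau i => .C (i + 1)

/-- The sort in which a function symbol takes its values. -/
def cod : TKFun 1 → TKRel 1
  | .S i => .V i
  | .pr0 i => .C i
  | .pr1 _ => .U
  | .tau i => .C i

/-- `M` is a model of `TK`. A many-sorted structure is coded as a one-sorted one: the sorts partition
the universe, and a function symbol is interpreted as the identity off its domain sort. -/
structure IsModel : Prop where
  /-- every element belongs to exactly one sort -/
  exists_unique_sort : ∀ x : M, ∃! s : TKRel 1, x ∈ sort M s
  /-- each function maps its domain sort to its codomain sort -/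
  mapsTo : ∀ f : TKFun 1, Set.MapsTo (app M f) (sort M (dom f)) (sort M (cod f))
  /-- coding convention for many-sorted structures -/
  off_dom : ∀ (f : TKFun 1) (x : M), x ∉ sort M (dom f) → app M f x = x
  infinite_U : (sort M .U).Infinite
  infinite_V : ∀ i, (sort M (.V i)).Infinite
  card_C : ∀ i, (sort M (.C i)).ncard = 2 ^ i
  tau_surj : ∀ i, Set.SurjOn (app M (.tau i)) (sort M (.C (i + 1))) (sort M (.C i))
  tau_fiber : ∀ i, ∀ c ∈ sort M (.C i), {d ∈ sort M (.C (i + 1)) | app M (.tau i) d = c}.ncard = 2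
  fiber_nonempty : ∀ i, ∀ c ∈ sort M (.C i), ∀ u ∈ sort M .U,
    ∃ x ∈ sort M (.V i), app M (.pr0 i) x = c ∧ app M (.pr1 i) x = u
  /-- `S i` is a successor function, as on `ℤ`: a bijection of `V i` without cycles -/
  S_bij : ∀ i, Set.BijOn (app M (.S i)) (sort M (.V i)) (sort M (.V i))
  S_acyclic : ∀ i, ∀ x ∈ sort M (.V i), ∀ n : ℕ, 0 < n → (app M (.S i))^[n] x ≠ x
  pr0_S : ∀ i, ∀ x ∈ sort M (.V i), app M (.pr0 i) (app M (.S i) x) = app M (.pr0 i) x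
  pr1_S : ∀ i, ∀ x ∈ sort M (.V i), app M (.pr1 i) (app M (.S i) x) = app M (.pr1 i) x

end TK

/-- `Mod(TK)`: the models of `TK` with universe `ℕ`. -/
def TKMod : Set (TKLang.Structure ℕ) := {M | @TK.IsModel ℕ M}

/-! ### Colorings of the binary tree -/

/-- `G = Aut(2^{<ω}, ≤)`: the automorphisms of the tree of finite binary sequences, ordered by
initial segment. -/
abbrev TreeAut : Type :=
  ((· <+: ·) : List Bool → List Bool → Prop) ≃r ((· <+: ·) : List Bool → List Bool → Prop)

/-- `X`: the space of colorings of `2^{<ω}` by natural numbers (with the product topology). -/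
abbrev Coloring : Type := List Bool → ℕ

/-- The action of `G × S_∞` on `X^ω`: `G` acts diagonally by `(g · c)(s) = c(g⁻¹ s)`, and
`S_∞` permutes the entries of a sequence. -/
def coloringAct (p : TreeAut × Equiv.Perm ℕ) (x : ℕ → Coloring) : ℕ → Coloring :=
  fun n s => x (p.2⁻¹ n) (p.1⁻¹ s)

/-- `E_{G × S_∞}`: the orbit equivalence relation of the action of `G × S_∞` on `X^ω`. -/
def ColoringEquiv (x y : ℕ → Coloring) : Prop :=
  ∃ p : TreeAut × Equiv.Perm ℕ, coloringAct p x = y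

/-! The heart is a coding by which isomorphism on any class of structures in a countable language
reduces to `ColoringEquiv` (`isoOn_borelReducible_coloringEquiv`). Fix countably many distinct
branches of the tree, divided into dense classes indexed by ω; class n stands for the element n.
Each finite list of branches gets a coloring that marks these branches and uses the levels of the
tree, which G preserves, to record the atomic facts true of the indices. An equivalence between two
such sequences of colorings permutes the branches and, since equality of indices is among the
recorded facts, also the classes; so it yields an isomorphism (`diagramColoring_equiv_iff`).
Conversely, since every class is dense, back and forth lifts a permutation σ of ω to a permutation
of the branches that sends class n to class σ n and preserves the levels at which branches split
(`exists_branch_equiv`). Such a permutation is induced by a tree automorphism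
(`exists_treeAut_branchTake`).

A model of TK is a full binary tree, a countably infinite set U and, over each pair of a node and a
point of U, a nonempty disjoint union of copies of ℤ. The numbers of copies determine the model, up
to automorphisms of the tree and permutations of U. With 0 standing for infinitely many copies,
these numbers form a sequence of colorings. This gives both reductions between TK and colorings
(`TK.ofColorings_equiv_iff`, `TK.ofColorings_toColorings_equiv`), and Borel completeness follows by
composing with the coding. -/

/-! ### Back and forth -/

/-- The back-and-forth method: a family of finite partial maps, determined by a condition on pairs
of points, in which every element of either side can be added, contains a bijection. -/
theorem exists_equiv_of_back_and_forth {α β : Type*} [Countable α] [Countable β]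
    (c : α × β → α × β → Prop) (inj : ∀ p q, c p q → (p.1 = q.1 ↔ p.2 = q.2))
    (left : ∀ f : Finset (α × β), (∀ p ∈ f, ∀ q ∈ f, c p q) → ∀ a, ∃ b,
      ∀ p ∈ insert (a, b) (f : Set (α × β)), ∀ q ∈ insert (a, b) (f : Set (α × β)), c p q)
    (right : ∀ f : Finset (α × β), (∀ p ∈ f, ∀ q ∈ f, c p q) → ∀ b, ∃ a,
      ∀ p ∈ insert (a, b) (f : Set (α × β)), ∀ q ∈ insert (a, b) (f : Set (α × β)), c p q) :
    ∃ e : α ≃ β, ∀ a a', c (a, e a) (a', e a') := by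
  classical
  cases nonempty_encodable α
  cases nonempty_encodable β
  let P := {f : Finset (α × β) // ∀ p ∈ f, ∀ q ∈ f, c p q}
  let D : α ⊕ β → Order.Cofinal P := fun x => Sum.recOn x
    (fun a => ⟨{f | ∃ b, (a, b) ∈ f.1}, fun f => by
      obtain ⟨b, hb⟩ := left f.1 f.2 a
      exact ⟨⟨insert (a, b) f.1, by simpa only [← Finset.mem_coe, Finset.coe_insert] using hb⟩,
        ⟨b, Finset.mem_insert_self _ _⟩, Finset.subset_insert _ _⟩⟩)
    (fun b => ⟨{f | ∃ a, (a, b) ∈ f.1}, fun f => by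
      obtain ⟨a, ha⟩ := right f.1 f.2 b
      exact ⟨⟨insert (a, b) f.1, by simpa only [← Finset.mem_coe, Finset.coe_insert] using ha⟩,
        ⟨a, Finset.mem_insert_self _ _⟩, Finset.subset_insert _ _⟩⟩)
  let I : Order.Ideal P := Order.idealOfCofinals ⟨∅, by simp⟩ D
  have hF : ∀ a, ∃ b, ∃ f ∈ I, (a, b) ∈ f.1 := fun a => by
    obtain ⟨f, ⟨b, hb⟩, hf⟩ := Order.cofinal_meets_idealOfCofinals ⟨∅, by simp⟩ D (Sum.inl a)
    exact ⟨b, f, hf, hb⟩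
  have hG : ∀ b, ∃ a, ∃ f ∈ I, (a, b) ∈ f.1 := fun b => by
    obtain ⟨f, ⟨a, ha⟩, hf⟩ := Order.cofinal_meets_idealOfCofinals ⟨∅, by simp⟩ D (Sum.inr b)
    exact ⟨a, f, hf, ha⟩
  -- The ideal is directed, so any two pairs that occur in it lie in a common finite approximation.
  have key : ∀ p q, (∃ f ∈ I, p ∈ f.1) → (∃ f ∈ I, q ∈ f.1) → c p q := by
    rintro p q ⟨f, hf, hp⟩ ⟨g, hg, hq⟩
    obtain ⟨m, -, fm, gm⟩ := I.directed _ hf _ hg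
    exact m.2 p (fm hp) q (gm hq)
  choose F hF using hF
  choose G hG using hG
  refine ⟨⟨F, G, fun a => ?_, fun b => ?_⟩, fun a a' => key _ _ (hF a) (hF a')⟩
  · exact (inj _ _ (key _ _ (hG (F a)) (hF a))).2 rfl
  · exact (inj _ _ (key _ _ (hF (G b)) (hG b))).1 rfl

/-! ### Automorphisms of the binary tree -/

/-- Immediate successors go to immediate successors. The prefix `t` of `g (s ++ [b])` that is one
longer than `g s` pulls back to a prefix of `s ++ [b]`; it cannot pull back to a prefix of `s`, as
`t` is longer than `g s`, so `t` is all of `g (s ++ [b])`. -/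
theorem TreeAut.length_apply (g : TreeAut) (s : List Bool) : (g s).length = s.length := by
  induction s using List.reverseRecOn with
  | nil =>
    have : g [] <+: g (g.symm []) := g.map_rel_iff.2 List.nil_prefix
    simpa using this
  | append_singleton s b ih =>
    have h1 : g s <+: g (s ++ [b]) := g.map_rel_iff.2 (List.prefix_append _ _)
    have hne : g s ≠ g (s ++ [b]) := fun h => by simpa using g.injective h
    have hlt : (g s).length < (g (s ++ [b])).length :=
      lt_of_le_of_ne h1.length_le fun h => hne (h1.eq_of_length h)
    let t := (g (s ++ [b])).take ((g s).length + 1)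
    have ht : t.length = (g s).length + 1 := by simp [t]; omega
    have hst : g s <+: t := List.prefix_of_prefix_length_le h1 (List.take_prefix _ _) (by omega)
    have h2 : g.symm t <+: s ++ [b] := by
      rw [← g.symm_apply_apply (s ++ [b])]
      exact g.symm.map_rel_iff.2 (List.take_prefix _ _)
    rcases List.prefix_concat_iff.1 h2 with h | h
    · have := congrArg (fun x => (g x).length) h
      simp only [RelIso.apply_symm_apply] at this
      simp [← this, ht, ih]
    · have h3 := g.map_rel_iff.2 h
      rw [g.apply_symm_apply] at h3
      have := h3.length_le
      omega

theorem TreeAut.apply_dropLast (g : TreeAut) (s : List Bool) :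
    g s.dropLast = (g s).dropLast := by
  have h : g s.dropLast <+: g s := g.map_rel_iff.2 (List.dropLast_prefix s)
  refine (List.prefix_of_prefix_length_le h (List.dropLast_prefix _) ?_).eq_of_length ?_ <;>
    simp [TreeAut.length_apply]

/-- A bijection of `2^{<ω}` which commutes with the predecessor map is an automorphism. -/
def TreeAut.ofEquiv (e : List Bool ≃ List Bool)
    (h : ∀ s, e s.dropLast = (e s).dropLast) : TreeAut where
  toEquiv := e
  map_rel_iff' := by
    have key : ∀ e : List Bool ≃ List Bool, (∀ s, e s.dropLast = (e s).dropLast) →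
        ∀ s t, s <+: t → e s <+: e t := by
      intro e h s t
      induction t using List.reverseRecOn with
      | nil => intro hs; rw [List.prefix_nil.1 hs]
      | append_singleton t b ih =>
        intro hs
        rcases List.prefix_concat_iff.1 hs with rfl | hs
        · exact List.prefix_rfl
        · have := h (t ++ [b])
          rw [List.dropLast_concat] at this
          exact (ih hs).trans (this ▸ List.dropLast_prefix _)
    refine fun {s t} => ⟨fun hst => ?_, key e h s t⟩
    have := key e.symm (fun s => e.injective (by simp [h])) _ _ hst
    simpa using this

/-! ### A countable dense set of branches -/

/-- A countable family of distinct branches of `2^{<ω}`. For each `n`, those with index `(n, w)`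
are dense. -/
def branch (p : ℕ × List Bool) (j : ℕ) : Bool :=
  p.2[j]?.getD (decide (j = Nat.pair p.2.length (Encodable.encode p)))

/-- The initial segment of length `k` of a branch. -/
def branchTake (p : ℕ × List Bool) (k : ℕ) : List Bool := (List.range k).map (branch p)

@[simp] theorem length_branchTake (p : ℕ × List Bool) (k : ℕ) : (branchTake p k).length = k := by
  simp [branchTake]

theorem branchTake_succ (p : ℕ × List Bool) (k : ℕ) :
    branchTake p (k + 1) = branchTake p k ++ [branch p k] := by
  simp [branchTake, List.range_succ]

theorem branchTake_succ_eq_iff (p q : ℕ × List Bool) (k : ℕ) :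
    branchTake p (k + 1) = branchTake q (k + 1) ↔
      branchTake p k = branchTake q k ∧ branch p k = branch q k := by
  simp [branchTake_succ, List.append_eq_append_iff_of_size_eq_right]

theorem branchTake_eq_iff {p q : ℕ × List Bool} {k : ℕ} :
    branchTake p k = branchTake q k ↔ ∀ j < k, branch p j = branch q j := by
  simp [branchTake]

theorem branchTake_eq_mono {p q : ℕ × List Bool} {i k : ℕ} (h : i ≤ k)
    (hk : branchTake p k = branchTake q k) : branchTake p i = branchTake q i :=
  branchTake_eq_iff.2 fun j hj => branchTake_eq_iff.1 hk j (hj.trans_le h)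

theorem branchTake_self (n : ℕ) (s : List Bool) : branchTake (n, s) s.length = s := by
  refine List.ext_getElem (by simp) fun j h _ => ?_
  have : j < s.length := by simpa using h
  simp [branchTake, branch, this]

/-- Beyond its stem, a branch takes the value `true` exactly once, at the position `Nat.pair
p.2.length (encode p)`; pairing with the length keeps this position beyond the stem. The last `true`
of a branch therefore reveals `p`. -/
theorem branch_injective : Function.Injective branch := by
  have key : ∀ p q, branch p = branch q → Nat.pair p.2.length (Encodable.encode p) ≤
      Nat.pair q.2.length (Encodable.encode q) := by
    intro p q h
    have h1 := congrFun h (Nat.pair p.2.length (Encodable.encode p))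
    have h2 : branch p (Nat.pair p.2.length (Encodable.encode p)) = true := by
      simp [branch, List.getElem?_eq_none (Nat.left_le_pair _ _)]
    rw [h2] at h1
    by_contra! hlt
    have := (Nat.left_le_pair q.2.length (Encodable.encode q)).trans hlt.le
    rw [branch, List.getElem?_eq_none this] at h1
    have := of_decide_eq_true h1.symm
    omega
  intro p q h
  have := (Nat.pair_eq_pair.1 ((key p q h).antisymm (key q p h.symm))).2
  exact Encodable.encode_injective this

/-- A point can be added to a finite partial map between branches that preserves the levels at which
branches split; the index of the new branch in the family of dense sets is prescribed. -/
theorem exists_branch_extension (f : Finset ((ℕ × List Bool) × (ℕ × List Bool)))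
    (hf : ∀ x ∈ f, ∀ y ∈ f, ∀ k,
      branchTake x.1 k = branchTake y.1 k ↔ branchTake x.2 k = branchTake y.2 k)
    (p : ℕ × List Bool) (hp : ∀ x ∈ f, x.1 ≠ p) (n : ℕ) :
    ∃ q : ℕ × List Bool, q.1 = n ∧ ∀ x ∈ f, ∀ k,
      branchTake x.1 k = branchTake p k ↔ branchTake x.2 k = branchTake q k := by
  classical
  have hsplit : ∀ x ∈ f, ∃ k, branchTake x.1 k = branchTake p k ∧ branch x.1 k ≠ branch p k := by
    intro x hx
    by_contra! h
    refine hp x hx (branch_injective (funext fun k => h k ?_))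
    induction k with
    | zero => simp [branchTake]
    | succ k ih => exact (branchTake_succ_eq_iff _ _ _).2 ⟨ih, h k ih⟩
  rcases f.eq_empty_or_nonempty with rfl | hne
  · exact ⟨(n, []), rfl, by simp⟩
  choose! lev hlev using hsplit
  -- `x₀.1` is a branch that leaves `p` last, at level `m`. The new branch follows `x₀.2` up to `m`
  -- and then turns away from it; density provides one with index `n` through that node.
  obtain ⟨x₀, hx₀, hmax⟩ := f.exists_max_image lev hne
  set m := lev x₀
  obtain ⟨hm, hm'⟩ := hlev x₀ hx₀
  let s := branchTake x₀.2 m ++ [!branch x₀.2 m]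
  have hs : branchTake (n, s) (m + 1) = s := by
    have := branchTake_self n s
    simpa [s] using this
  rw [branchTake_succ] at hs
  obtain ⟨hq, hq'⟩ := List.append_inj' hs rfl
  refine ⟨(n, s), rfl, fun x hx k => ?_⟩
  rcases le_or_gt k m with hk | hk
  · rw [branchTake_eq_mono hk hq, ← branchTake_eq_mono hk hm]
    exact hf x hx x₀ hx₀ k
  -- Above level `m`, `p` has left every branch. If some `x.2` still agreed with the new branch,
  -- then `x.1` would split from `x₀.1` exactly at `m`, as `p` does; with only two directions, `x.1`
  -- and `p` would turn the same way at `m`, although `m` would have to be their splitting level.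
  · have h1 : ¬ branchTake x.1 k = branchTake p k := fun h =>
      (hlev x hx).2 (branchTake_eq_iff.1 h _ ((hmax x hx).trans_lt hk))
    refine iff_of_false h1 fun h => ?_
    obtain ⟨h2, h3⟩ := (branchTake_succ_eq_iff _ _ _).1 (branchTake_eq_mono hk h)
    have h4 := (hf x hx x₀ hx₀ m).2 (h2.trans hq)
    have h5 : ¬ branchTake x.1 (m + 1) = branchTake x₀.1 (m + 1) := fun h => by
      have := ((branchTake_succ_eq_iff _ _ _).1 ((hf x hx x₀ hx₀ (m + 1)).1 h)).2
      simp at hq'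
      simp [← this, h3] at hq'
    have h6 : branch x.1 m ≠ branch x₀.1 m := fun h =>
      h5 ((branchTake_succ_eq_iff _ _ _).2 ⟨h4, h⟩)
    have h7 : branch x.1 m = branch p m :=
      (by decide : ∀ a b c : Bool, a ≠ b → b ≠ c → a = c) _ _ _ h6 hm'
    have h8 : lev x = m := by
      refine le_antisymm (hmax x hx) (le_of_not_gt fun hlt => (hlev x hx).2 ?_)
      exact branchTake_eq_iff.1 (h4.trans hm) _ hlt
    exact (hlev x hx).2 (h8 ▸ h7)

/-- Density of each class allows the image of a branch to be sought in the prescribed class `σ p.1`,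
whatever splitting levels are required. Preserving the levels of agreement already forces
injectivity, since distinct branches separate somewhere. -/
theorem exists_branch_equiv (σ : Equiv.Perm ℕ) :
    ∃ θ : Equiv.Perm (ℕ × List Bool), (∀ p, (θ p).1 = σ p.1) ∧
      ∀ p q k, branchTake p k = branchTake q k ↔ branchTake (θ p) k = branchTake (θ q) k := by
  let c : (ℕ × List Bool) × (ℕ × List Bool) → (ℕ × List Bool) × (ℕ × List Bool) → Prop :=
    fun x y => (x.2.1 = σ x.1.1 ∧ y.2.1 = σ y.1.1) ∧
      ∀ k, branchTake x.1 k = branchTake y.1 k ↔ branchTake x.2 k = branchTake y.2 k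
  suffices h : ∃ θ : Equiv.Perm (ℕ × List Bool), ∀ p q, c (p, θ p) (q, θ q) by
    obtain ⟨θ, hθ⟩ := h
    exact ⟨θ, fun p => (hθ p p).1.1, fun p q => (hθ p q).2⟩
  refine exists_equiv_of_back_and_forth c ?_ ?_ ?_
  · rintro p q ⟨-, h⟩
    have key : ∀ p q : ℕ × List Bool, p = q ↔ ∀ k, branchTake p k = branchTake q k := fun p q =>
      ⟨by rintro rfl k; rfl, fun h => branch_injective <| funext fun k =>
        branchTake_eq_iff.1 (h (k + 1)) k k.lt_succ_self⟩
    rw [key, key]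
    exact forall_congr' h
  · intro f hf p
    by_cases hp : ∀ x ∈ f, x.1 ≠ p
    · obtain ⟨q, hq, h⟩ := exists_branch_extension f (fun x hx y hy => (hf x hx y hy).2) p hp
        (σ p.1)
      refine ⟨q, ?_⟩
      rintro x (rfl | hx) y (rfl | hy)
      · exact ⟨⟨hq, hq⟩, by simp⟩
      · exact ⟨⟨hq, (hf y hy y hy).1.1⟩, fun k => by rw [eq_comm, h y hy k, eq_comm]⟩
      · exact ⟨⟨(hf x hx x hx).1.1, hq⟩, h x hx⟩
      · exact hf x hx y hy
    · push Not at hp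
      obtain ⟨x, hx, rfl⟩ := hp
      refine ⟨x.2, ?_⟩
      rw [Prod.mk.eta, Set.insert_eq_of_mem (Finset.mem_coe.2 hx)]
      exact hf
  · intro f hf q
    by_cases hq : ∀ x ∈ f, x.2 ≠ q
    -- The extension lemma applies to the inverse partial map and to `σ.symm`.
    · obtain ⟨p, hp, h⟩ := exists_branch_extension (f.image Prod.swap)
        (by
          simp only [Finset.forall_mem_image]
          exact fun x hx y hy k => ((hf x hx y hy).2 k).symm) q
        (by
          simp only [Finset.forall_mem_image]
          exact hq) (σ.symm q.1)
      have hp' : q.1 = σ p.1 := by simp [hp]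
      have h' : ∀ x ∈ f, ∀ k, branchTake x.1 k = branchTake p k ↔ branchTake x.2 k = branchTake q k :=
        fun x hx k => (h x.swap (Finset.mem_image_of_mem _ hx) k).symm
      refine ⟨p, ?_⟩
      rintro x (rfl | hx) y (rfl | hy)
      · exact ⟨⟨hp', hp'⟩, by simp⟩
      · exact ⟨⟨hp', (hf y hy y hy).1.1⟩, fun k => by rw [eq_comm, h' y hy k, eq_comm]⟩
      · exact ⟨⟨(hf x hx x hx).1.1, hp'⟩, h' x hx⟩
      · exact hf x hx y hy
    · push Not at hq
      obtain ⟨x, hx, rfl⟩ := hq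
      refine ⟨x.1, ?_⟩
      rw [Prod.mk.eta, Set.insert_eq_of_mem (Finset.mem_coe.2 hx)]
      exact hf

/-- The tree automorphism induced by a permutation of a dense set of branches. -/
theorem exists_treeAut_branchTake (θ : Equiv.Perm (ℕ × List Bool))
    (hθ : ∀ p q k, branchTake p k = branchTake q k ↔ branchTake (θ p) k = branchTake (θ q) k) :
    ∃ g : TreeAut, ∀ p k, g (branchTake p k) = branchTake (θ p) k := by
  -- A node `s` is moved along the branch `(0, s)`, which passes through it; by `hθ`, any other
  -- branch through `s` gives the same image.
  let G : Equiv.Perm (ℕ × List Bool) → List Bool → List Bool :=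
    fun θ s => branchTake (θ (0, s)) s.length
  have hG : ∀ θ : Equiv.Perm (ℕ × List Bool),
      (∀ p q k, branchTake p k = branchTake q k ↔ branchTake (θ p) k = branchTake (θ q) k) →
      ∀ p k, G θ (branchTake p k) = branchTake (θ p) k := fun θ hθ p k => by
    have := branchTake_self 0 (branchTake p k)
    rw [length_branchTake] at this
    simpa [G] using (hθ _ _ k).1 this
  have hinv : ∀ p q k, branchTake p k = branchTake q k ↔
      branchTake (θ.symm p) k = branchTake (θ.symm q) k := fun p q k => by
    rw [hθ (θ.symm p)]; simp
  have hex : ∀ s : List Bool, ∃ p k, s = branchTake p k :=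
    fun s => ⟨(0, s), s.length, (branchTake_self 0 s).symm⟩
  refine ⟨TreeAut.ofEquiv ⟨G θ, G θ.symm, fun s => ?_, fun s => ?_⟩ fun s => ?_, hG θ hθ⟩
  · obtain ⟨p, k, rfl⟩ := hex s
    simp [hG _ hθ, hG _ hinv]
  · obtain ⟨p, k, rfl⟩ := hex s
    simp [hG _ hθ, hG _ hinv]
  · obtain ⟨p, k, rfl⟩ := hex s
    cases k with
    | zero =>
      have := hG θ hθ p 0
      simp only [branchTake, List.range_zero, List.map_nil] at this
      simp [branchTake, this]
    | succ k =>
      rw [Equiv.coe_fn_mk, hG _ hθ, branchTake_succ, branchTake_succ, List.dropLast_concat,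
        List.dropLast_concat, hG _ hθ]

/-! ### Borel reductions -/

instance structureMeasurableSpace (L : FirstOrder.Language) : MeasurableSpace (L.Structure ℕ) :=
  borel _

instance structureBorelSpace (L : FirstOrder.Language) : BorelSpace (L.Structure ℕ) := ⟨rfl⟩

theorem BorelReducible.of_measurable {α β : Type*} [TopologicalSpace α] [TopologicalSpace β]
    [MeasurableSpace α] [MeasurableSpace β] [BorelSpace α] [BorelSpace β]
    {E : α → α → Prop} {F : β → β → Prop} {f : α → β} (hf : Measurable f)
    (h : ∀ x y, E x y ↔ F (f x) (f y)) : BorelReducible E F := by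
  refine ⟨f, ?_, h⟩
  rw [← BorelSpace.measurable_eq (α := α), ← BorelSpace.measurable_eq (α := β)]
  exact hf

theorem BorelReducible.trans {α β γ : Type*} [TopologicalSpace α] [TopologicalSpace β]
    [TopologicalSpace γ] {E : α → α → Prop} {F : β → β → Prop} {G : γ → γ → Prop}
    (h₁ : BorelReducible E F) (h₂ : BorelReducible F G) : BorelReducible E G := by
  obtain ⟨f, hf, hf'⟩ := h₁
  obtain ⟨g, hg, hg'⟩ := h₂
  let _ := borel α
  let _ := borel β
  let _ := borel γ
  exact ⟨g ∘ f, hg.comp hf, fun x y => (hf' x y).trans (hg' _ _)⟩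

theorem measurable_funMap {L : FirstOrder.Language} {n : ℕ} (f : L.Functions n) (v : Fin n → ℕ) :
    Measurable fun M : L.Structure ℕ => M.funMap f v :=
  measurable_to_countable' fun k => IsOpen.measurableSet <|
    TopologicalSpace.isOpen_generateFrom_of_mem (Or.inl ⟨n, f, v, k, rfl⟩)

theorem measurable_relMap {L : FirstOrder.Language} {n : ℕ} (R : L.Relations n) (v : Fin n → ℕ) :
    Measurable fun M : L.Structure ℕ => M.RelMap R v :=
  measurableSet_setOfPred.1 <| IsOpen.measurableSet <|
    TopologicalSpace.isOpen_generateFrom_of_mem (Or.inr ⟨n, R, v, Or.inl rfl⟩)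

theorem coloringEquiv_iff {x y : ℕ → Coloring} :
    ColoringEquiv x y ↔ ∃ (g : TreeAut) (σ : Equiv.Perm ℕ), ∀ n s, y (σ n) (g s) = x n s := by
  constructor
  · rintro ⟨⟨g, σ⟩, rfl⟩
    refine ⟨g, σ, fun n s => ?_⟩
    change x (σ⁻¹ (σ n)) (g⁻¹ (g s)) = x n s
    simp
  · rintro ⟨g, σ, h⟩
    refine ⟨⟨g, σ⟩, funext fun n => funext fun s => ?_⟩
    change x (σ⁻¹ n) (g⁻¹ s) = y n s
    simp [← h]

/-! ### Coding a countable structure by a sequence of colorings -/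

/-- The colorings that code a family `A` of predicates on finite sequences of natural numbers. The
coloring attached to a finite sequence of branches marks these branches, and records which members of
`A` hold of the sequence of their indices. -/
noncomputable def diagramColoring {ι : Type*} [Encodable ι] (A : ι → List ℕ → Prop)
    (l : List (ℕ × List Bool)) : Coloring := fun s =>
  open Classical in
  -- The level of `s` names the member of `A`, because tree automorphisms preserve levels.
  Encodable.encode (l.map fun p => decide (branchTake p s.length = s),
    decide (∃ a ∈ (Encodable.decode s.length : Option ι), A a (l.map Prod.fst)))

theorem diagramColoring_eq_iff {ι : Type*} [Encodable ι] {A B : ι → List ℕ → Prop}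
    {l l' : List (ℕ × List Bool)} {s t : List Bool} :
    diagramColoring A l s = diagramColoring B l' t ↔
      (l.map fun p => (branchTake p s.length = s)) =
        (l'.map fun p => (branchTake p t.length = t)) ∧
      ((∃ a ∈ (Encodable.decode s.length : Option ι), A a (l.map Prod.fst)) ↔
        ∃ a ∈ (Encodable.decode t.length : Option ι), B a (l'.map Prod.fst)) := by
  classical
  rw [diagramColoring, diagramColoring, Encodable.encode_inj, Prod.mk.injEq, decide_eq_decide]
  refine and_congr_left fun _ => ⟨fun h => ?_, fun h => ?_⟩
  · simpa [Function.comp_def] using congrArg (List.map fun b : Bool => (b = true)) h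
  · have := congrArg (List.map fun p : Prop => decide p) h
    simp only [List.map_map, Function.comp_def] at this
    convert this

theorem eq_of_branchTake_eq {p q : ℕ × List Bool} (h : ∀ k, branchTake p k = branchTake q k) :
    p = q :=
  branch_injective <| funext fun k => branchTake_eq_iff.1 (h (k + 1)) k k.lt_succ_self

/-- The marks force the permutation of lists to be induced entrywise by a permutation θ of branches,
namely the action of the tree automorphism. The predicate `e`, equality, makes θ respect classes, so
θ descends to a permutation of the indices. The converse lifts σ to the branches. -/
theorem diagramColoring_equiv_iff {ι : Type*} [Encodable ι] {A B : ι → List ℕ → Prop} (e : ι)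
    (hA : ∀ l, A e l ↔ ∃ a, l = [a, a]) (hB : ∀ l, B e l ↔ ∃ a, l = [a, a])
    (E : ℕ ≃ List (ℕ × List Bool)) :
    ColoringEquiv (fun n => diagramColoring A (E n)) (fun n => diagramColoring B (E n)) ↔
      ∃ σ : Equiv.Perm ℕ, ∀ a l, A a l ↔ B a (l.map σ) := by
  rw [coloringEquiv_iff]
  constructor
  · rintro ⟨g, ρ, h⟩
    let r : List (ℕ × List Bool) ≃ List (ℕ × List Bool) := (E.symm.trans ρ).trans E
    have hr : ∀ l s, diagramColoring B (r l) (g s) = diagramColoring A l s := fun l s => by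
      simpa [r] using h (E.symm l) s
    simp only [diagramColoring_eq_iff, TreeAut.length_apply] at hr
    have hlen : ∀ l, (r l).length = l.length := fun l => by
      simpa using congrArg List.length (hr l []).1
    -- At the node where `l[j]` has height `k`, the `j`-th mark of `l` is true, hence so is the
    -- `j`-th mark of `r l` at the image node.
    have hget : ∀ l j (h₁ : j < (r l).length) (h₂ : j < l.length) k,
        branchTake (r l)[j] k = g (branchTake l[j] k) := fun l j h₁ h₂ k => by
      have := List.getElem_of_eq (hr l (branchTake l[j] k)).1 (i := j) (by simpa using h₁)
      simpa using this
    have hsing : ∀ p, ∃ q, r [p] = [q] := fun p => List.length_eq_one_iff.1 (hlen [p])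
    choose θ hθ using hsing
    have hθg : ∀ p k, branchTake (θ p) k = g (branchTake p k) := fun p k => by
      simpa [hθ] using hget [p] 0 (by simp [hlen]) (by simp) k
    have hrθ : ∀ l, r l = l.map θ := fun l => by
      refine List.ext_getElem (by simp [hlen]) fun j h₁ h₂ => eq_of_branchTake_eq fun k => ?_
      rw [hget l j h₁ (by simpa using h₂), List.getElem_map, hθg]
    have hθsurj : ∀ q, ∃ p, θ p = q := fun q => by
      obtain ⟨p, hp⟩ := List.length_eq_one_iff.1 ((hlen (r.symm [q])).symm.trans (by simp))
      exact ⟨p, by simpa [← hp] using (hθ p).symm⟩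
    have hAB : ∀ a (l : List (ℕ × List Bool)), A a (l.map Prod.fst) ↔ B a ((l.map θ).map Prod.fst) := fun a l => by
      -- Any node at level `encode a` shows the truth value of the predicate `a`.
      have := (hr l (List.replicate (Encodable.encode a) false)).2
      rw [hrθ] at this
      simpa using this.symm
    have hfst : ∀ p q : ℕ × List Bool, p.1 = q.1 ↔ (θ p).1 = (θ q).1 := fun p q => by
      have := hAB e [p, q]
      rw [hA, hB] at this
      simpa [eq_comm] using this
    have hbij : Function.Bijective fun n => (θ (n, [])).1 :=
      ⟨fun m n h => (hfst _ _).2 h, fun n => by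
        obtain ⟨p, hp⟩ := hθsurj (n, [])
        exact ⟨p.1, by simpa [hp] using ((hfst p (p.1, [])).1 rfl).symm⟩⟩
    refine ⟨Equiv.ofBijective _ hbij, fun a l => ?_⟩
    have := hAB a (l.map fun n => (n, []))
    simpa [Function.comp_def] using this
  · rintro ⟨σ, hσ⟩
    obtain ⟨θ, hθ, hθ'⟩ := exists_branch_equiv σ
    obtain ⟨g, hg⟩ := exists_treeAut_branchTake θ hθ'
    refine ⟨g, (E.trans (Equiv.listEquivOfEquiv θ)).trans E.symm, fun n s => ?_⟩
    have hl : ∀ l, (Equiv.listEquivOfEquiv θ) l = l.map θ := fun l => rfl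
    simp only [Equiv.trans_apply, Equiv.apply_symm_apply, hl, diagramColoring_eq_iff,
      TreeAut.length_apply, List.map_map, Function.comp_def, hθ, hσ, ← hg, g.injective.eq_iff,
      and_self]

/-- The graphs of the symbols of a language in a structure, and equality, as predicates on finite
sequences. -/
def atomicDiagram {L : FirstOrder.Language} (M : L.Structure ℕ) :
    Option L.Symbols → List ℕ → Prop
  | none, l => ∃ a, l = [a, a]
  | some (.inl ⟨n, f⟩), l => ∃ v : Fin n → ℕ, l = M.funMap f v :: List.ofFn v
  | some (.inr ⟨n, R⟩), l => ∃ v : Fin n → ℕ, l = List.ofFn v ∧ M.RelMap R v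

theorem nonempty_equiv_iff {L : FirstOrder.Language} {M N : L.Structure ℕ} :
    Nonempty (@FirstOrder.Language.Equiv L ℕ ℕ M N) ↔ ∃ σ : Equiv.Perm ℕ,
      (∀ n (f : L.Functions n) v, σ (M.funMap f v) = N.funMap f (σ ∘ v)) ∧
      ∀ n (R : L.Relations n) v, N.RelMap R (σ ∘ v) ↔ M.RelMap R v := by
  constructor
  · rintro ⟨@⟨σ, hf, hR⟩⟩
    exact ⟨σ, fun n f v => hf f v, fun n R v => hR R v⟩
  · rintro ⟨σ, hf, hR⟩
    exact ⟨@FirstOrder.Language.Equiv.mk L ℕ ℕ M N σ (fun {n} => hf n) (fun {n} => hR n)⟩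

theorem nonempty_equiv_iff_atomicDiagram {L : FirstOrder.Language} {M N : L.Structure ℕ} :
    Nonempty (@FirstOrder.Language.Equiv L ℕ ℕ M N) ↔
      ∃ σ : Equiv.Perm ℕ, ∀ a l, atomicDiagram M a l ↔ atomicDiagram N a (l.map σ) := by
  rw [nonempty_equiv_iff]
  refine exists_congr fun σ => ⟨fun ⟨hf, hR⟩ => ?_, fun h => ⟨fun n f v => ?_, fun n R v => ?_⟩⟩
  · have hsurj : ∀ {n : ℕ} (w : Fin n → ℕ), ∃ v, w = σ ∘ v :=
      fun w => ⟨σ.symm ∘ w, by ext; simp⟩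
    have hinj : Function.Injective (List.map σ) := List.map_injective_iff.2 σ.injective
    rintro (_ | ⟨n, f⟩ | ⟨n, R⟩) l
    · constructor
      · rintro ⟨a, rfl⟩
        exact ⟨σ a, rfl⟩
      · rintro ⟨a, h⟩
        exact ⟨σ.symm a, hinj (by simpa using h)⟩
    · constructor
      · rintro ⟨v, rfl⟩
        exact ⟨σ ∘ v, by rw [List.map_cons, List.map_ofFn, hf]⟩
      · rintro ⟨w, h⟩
        obtain ⟨v, rfl⟩ := hsurj w
        exact ⟨v, hinj (by rw [h, List.map_cons, List.map_ofFn, hf])⟩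
    · constructor
      · rintro ⟨v, rfl, hv⟩
        exact ⟨σ ∘ v, by rw [List.map_ofFn], (hR n R v).2 hv⟩
      · rintro ⟨w, h, hw⟩
        obtain ⟨v, rfl⟩ := hsurj w
        exact ⟨v, hinj (by rw [h, List.map_ofFn]), (hR n R v).1 hw⟩
  · obtain ⟨w, hw⟩ := (h (some (.inl ⟨n, f⟩)) _).1 ⟨v, rfl⟩
    rw [List.map_cons, List.map_ofFn, List.cons.injEq, List.ofFn_injective.eq_iff] at hw
    exact hw.2 ▸ hw.1
  · have hM : ∀ (M : L.Structure ℕ) (v : Fin n → ℕ),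
        atomicDiagram M (some (.inr ⟨n, R⟩)) (List.ofFn v) ↔ M.RelMap R v := fun M v => by
      simp only [atomicDiagram, List.ofFn_injective.eq_iff, exists_eq_left']
    rw [← hM, ← hM, h, List.map_ofFn]

theorem measurable_atomicDiagram {L : FirstOrder.Language} (a : Option L.Symbols) (l : List ℕ) :
    Measurable fun M : L.Structure ℕ => atomicDiagram M a l := by
  rcases a with _ | ⟨n, f⟩ | ⟨n, R⟩
  · exact measurable_const
  · refine Measurable.exists fun v => ?_
    rcases l with _ | ⟨a, l⟩
    · simp
    · simp only [List.cons.injEq]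
      refine Measurable.and ?_ measurable_const
      exact measurableSet_setOfPred.1 (measurableSet_eq_fun measurable_const (measurable_funMap f v))
  · exact Measurable.exists fun v => measurable_const.and (measurable_relMap R v)

/-- Isomorphism of countable structures in a countable language Borel reduces to
`E_{G × S_∞}`. -/
theorem isoOn_borelReducible_coloringEquiv {L : FirstOrder.Language} [Countable L.Symbols]
    (K : Set (L.Structure ℕ)) : BorelReducible (IsoOn K) ColoringEquiv := by
  cases nonempty_encodable L.Symbols
  obtain ⟨E⟩ : Nonempty (ℕ ≃ List (ℕ × List Bool)) := nonempty_equiv_of_countable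
  refine BorelReducible.of_measurable
    (f := fun M : K => fun n => diagramColoring (atomicDiagram M.1) (E n)) ?_ fun M N => ?_
  · refine measurable_pi_lambda _ fun n => measurable_pi_lambda _ fun s => ?_
    classical
    have h : Measurable fun M : K => ∃ a ∈ (Encodable.decode s.length : Option (Option L.Symbols)),
        atomicDiagram M.1 a ((E n).map Prod.fst) :=
      Measurable.exists fun a => measurable_const.and
        ((measurable_atomicDiagram a _).comp measurable_subtype_coe)
    -- Only one truth value in each color depends on `M`; the marks are constant.
    have h' : Measurable fun p : Prop => Encodable.encode
        ((E n).map fun p => decide (branchTake p s.length = s), decide p) := measurable_from_top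
    convert h'.comp h
    simp only [diagramColoring, Function.comp_apply]
    congr!
  · rw [diagramColoring_equiv_iff none (fun _ => Iff.rfl) (fun _ => Iff.rfl)]
    exact nonempty_equiv_iff_atomicDiagram

/-! ### Permutations with infinite cycles only -/

/-- An index set for the orbits of a permutation with `k` orbits, or with infinitely many orbits if
`k = 0`. -/
abbrev OrbitIndex (k : ℕ) : Type := {j : ℕ // k = 0 ∨ j < k}

instance (k : ℕ) : Nonempty (OrbitIndex k) := ⟨⟨0, k.eq_zero_or_pos⟩⟩

/-- The convention that 0 means infinite agrees with `Nat.card` and `Set.ncard`, so the code of a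
permutation is recovered as a cardinality. -/
theorem card_orbitIndex (k : ℕ) : Nat.card (OrbitIndex k) = k := by
  rcases k.eq_zero_or_pos with rfl | h
  · have : Infinite (OrbitIndex 0) :=
      Infinite.of_injective (fun j : ℕ => ⟨j, Or.inl rfl⟩) fun _ _ h => congrArg Subtype.val h
    exact Nat.card_eq_zero_of_infinite
  · have e : OrbitIndex k ≃ Fin k :=
      ⟨fun j => ⟨j.1, j.2.resolve_left h.ne'⟩, fun j => ⟨j.1, Or.inr j.2⟩, fun _ => rfl, fun _ => rfl⟩
    simpa using Nat.card_congr e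

/-- The empty set must be excluded: its `ncard` is also 0, which here stands for infinite. -/
theorem nonempty_equiv_orbitIndex {R : Set ℕ} (hR : R.Nonempty) :
    Nonempty (OrbitIndex R.ncard ≃ R) := by
  rcases R.finite_or_infinite with h | h
  · have hpos : 0 < R.ncard := (Set.ncard_pos h).2 hR
    have : Finite R := h
    have : Finite (OrbitIndex R.ncard) :=
      Nat.finite_of_card_ne_zero (by rw [card_orbitIndex]; exact hpos.ne')
    exact (Finite.card_eq (α := OrbitIndex R.ncard)).1 (card_orbitIndex _)
  · have : Infinite R := h.to_subtype
    have : Infinite (OrbitIndex R.ncard) := by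
      rw [h.ncard]
      exact Infinite.of_injective (fun j : ℕ => ⟨j, Or.inl rfl⟩) fun _ _ h => congrArg Subtype.val h
    exact nonempty_equiv_of_countable

/-- A bijection of `ℕ` with the disjoint union of copies of `ℤ`. -/
noncomputable def orbitEquiv (k : ℕ) : ℕ ≃ OrbitIndex k × ℤ :=
  nonempty_equiv_of_countable.some

/-- A permutation of `ℕ` with exactly `k` orbits (infinitely many if `k = 0`), all of them
infinite. -/
noncomputable def orbitSucc (k : ℕ) : Equiv.Perm ℕ :=
  ((orbitEquiv k).trans ((Equiv.refl _).prodCongr (Equiv.addRight 1))).trans (orbitEquiv k).symm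

theorem orbitEquiv_orbitSucc (k z : ℕ) :
    orbitEquiv k (orbitSucc k z) = ((orbitEquiv k z).1, (orbitEquiv k z).2 + 1) := by
  simp [orbitSucc, Prod.map]

theorem orbitEquiv_orbitSucc_iterate (k z n : ℕ) :
    orbitEquiv k ((orbitSucc k)^[n] z) = ((orbitEquiv k z).1, (orbitEquiv k z).2 + n) := by
  induction n with
  | zero => simp
  | succ n ih =>
    rw [Function.iterate_succ_apply', orbitEquiv_orbitSucc, ih]
    simp [add_assoc]

theorem orbitSucc_iterate_ne (k z : ℕ) {n : ℕ} (hn : 0 < n) : (orbitSucc k)^[n] z ≠ z := by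
  intro h
  have := orbitEquiv_orbitSucc_iterate k z n
  rw [h] at this
  have := congrArg Prod.snd this
  simp at this
  omega

/-- A conjugacy commutes with translation on the copies of ℤ, so it maps each copy onto a copy and
induces a bijection of the index sets. -/
theorem eq_of_orbitSucc_conj {k k' : ℕ} (ψ : Equiv.Perm ℕ)
    (h : ∀ z, ψ (orbitSucc k z) = orbitSucc k' (ψ z)) : k = k' := by
  let φ : OrbitIndex k × ℤ ≃ OrbitIndex k' × ℤ :=
    ((orbitEquiv k).symm.trans ψ).trans (orbitEquiv k')
  have hsucc : ∀ j z, φ (j, z + 1) = ((φ (j, z)).1, (φ (j, z)).2 + 1) := fun j z => by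
    have h1 := congrArg (orbitEquiv k') (h ((orbitEquiv k).symm (j, z)))
    rw [orbitEquiv_orbitSucc] at h1
    have h2 : orbitSucc k ((orbitEquiv k).symm (j, z)) = (orbitEquiv k).symm (j, z + 1) := by
      apply (orbitEquiv k).injective
      simp [orbitEquiv_orbitSucc]
    rw [h2] at h1
    exact h1
  have hφ : ∀ j z, φ (j, z) = ((φ (j, 0)).1, (φ (j, 0)).2 + z) := fun j z => by
    induction z with
    | zero => simp
    | succ n ih => rw [hsucc, ih, add_assoc]
    | pred n ih =>
      have := hsucc j (-(n : ℤ) - 1)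
      rw [sub_add_cancel, ih] at this
      ext
      · exact congrArg (fun p => p.1.1) this.symm
      · have := congrArg Prod.snd this
        simp only at this ⊢
        omega
  rw [← card_orbitIndex k, ← card_orbitIndex k']
  refine Nat.card_eq_of_bijective (fun j => (φ (j, 0)).1) ⟨fun j j' hj => ?_, fun q => ?_⟩
  -- If two copies have images in the same copy, a translation takes one base point to the preimage
  -- of the other image.
  · have : φ (j, (φ (j', 0)).2 - (φ (j, 0)).2) = φ (j', 0) := by
      rw [hφ]
      ext
      · exact congrArg Subtype.val hj
      · simp
    exact congrArg Prod.fst (φ.injective this)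
  · refine ⟨(φ.symm (q, 0)).1, ?_⟩
    have := hφ (φ.symm (q, 0)).1 (φ.symm (q, 0)).2
    rw [Prod.mk.eta, φ.apply_symm_apply] at this
    exact (congrArg Prod.fst this).symm

/-- The least elements of the orbits of `S` in `F`. -/
def orbitReps (S : ℕ → ℕ) (F : Set ℕ) : Set ℕ :=
  {a | a ∈ F ∧ ∀ b ∈ F, ∀ n : ℕ, S^[n] a = b ∨ S^[n] b = a → a ≤ b}

/-- A permutation of a nonempty set of natural numbers without finite cycles is determined up to
isomorphism by the number of its orbits. -/
theorem exists_bijOn_orbitSucc {S : ℕ → ℕ} {F : Set ℕ} (hne : F.Nonempty) (hS : Set.BijOn S F F)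
    (hac : ∀ a ∈ F, ∀ n : ℕ, 0 < n → S^[n] a ≠ a) :
    ∃ e : ℕ → ℕ, Set.BijOn e Set.univ F ∧
      ∀ z, e (orbitSucc (orbitReps S F).ncard z) = S (e z) := by
  let τ : Equiv.Perm F := hS.equiv S
  have hτ : ∀ (n : ℕ) a, ((τ ^ n) a).1 = S^[n] a := fun n a => by
    induction n with
    | zero => rfl
    | succ n ih =>
      rw [pow_succ', Equiv.Perm.mul_apply, Function.iterate_succ_apply', ← ih]
      rfl
  -- Integer powers are turned into forward iterates in one direction or the other, the form used in
  -- `orbitReps`.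
  have hz : ∀ (z : ℤ) (a b : F), (τ ^ z) a = b →
      S^[z.natAbs] a = b ∨ S^[z.natAbs] b = a := fun z a b h => by
    rcases z.natAbs_eq with hz | hz <;> generalize z.natAbs = n at hz <;> subst hz
    · left
      rw [← hτ, ← h, zpow_natCast]
    · right
      rw [← hτ, ← h, zpow_neg, zpow_natCast, ← Equiv.Perm.mul_apply, mul_inv_cancel, Equiv.Perm.one_apply]
  have hleast : ∀ a ∈ F, ∃ r : orbitReps S F, ∃ z : ℤ, ((τ ^ z) ⟨r, r.2.1⟩).1 = a := by
    intro a ha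
    let B : Set ℕ := {b | ∃ z : ℤ, ((τ ^ z) ⟨a, ha⟩).1 = b}
    obtain ⟨z, hz₀⟩ : sInf B ∈ B := Nat.sInf_mem ⟨a, 0, rfl⟩
    have hF : sInf B ∈ F := hz₀ ▸ Subtype.mem _
    have hr : (τ ^ z) ⟨a, ha⟩ = ⟨sInf B, hF⟩ := Subtype.ext hz₀
    refine ⟨⟨sInf B, hF, fun b hb n hn => Nat.sInf_le ?_⟩, -z, ?_⟩
    · rcases hn with hn | hn
      · refine ⟨n + z, ?_⟩
        rw [zpow_add, Equiv.Perm.mul_apply, hr, zpow_natCast, hτ, hn]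
      · refine ⟨-n + z, ?_⟩
        have : (τ ^ n) ⟨b, hb⟩ = ⟨sInf B, hF⟩ := Subtype.ext ((hτ n _).trans hn)
        rw [zpow_add, Equiv.Perm.mul_apply, hr, ← this, zpow_neg, zpow_natCast,
          ← Equiv.Perm.mul_apply, inv_mul_cancel, Equiv.Perm.one_apply]
    · rw [← hr, zpow_neg, ← Equiv.Perm.mul_apply, inv_mul_cancel, Equiv.Perm.one_apply]
  obtain ⟨a₀, ha₀⟩ := hne
  obtain ⟨ε⟩ := nonempty_equiv_orbitIndex ⟨_, (hleast a₀ ha₀).choose.2⟩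
  -- The pair `(j, z)` goes to the `z`-th translate of the `j`-th orbit representative.
  let Φ : OrbitIndex (orbitReps S F).ncard × ℤ → ℕ := fun p =>
    ((τ ^ p.2) ⟨ε p.1, (ε p.1).2.1⟩).1
  have hΦ : Set.BijOn Φ Set.univ F := by
    refine ⟨fun p _ => Subtype.mem _, ?_, fun a ha => ?_⟩
    · rintro ⟨j, z⟩ - ⟨j', z'⟩ - h
      have h1 : (τ ^ (z - z')) ⟨ε j, (ε j).2.1⟩ = ⟨ε j', (ε j').2.1⟩ := by
        rw [sub_eq_neg_add, zpow_add, Equiv.Perm.mul_apply, show (τ ^ z) _ = _ from Subtype.ext h,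
          zpow_neg, ← Equiv.Perm.mul_apply, inv_mul_cancel, Equiv.Perm.one_apply]
      have h2 := hz _ _ _ h1
      have h3 : (ε j).1 = (ε j').1 :=
        le_antisymm ((ε j).2.2 _ (ε j').2.1 _ h2) ((ε j').2.2 _ (ε j).2.1 _ h2.symm)
      have h4 : j = j' := ε.injective (Subtype.ext h3)
      subst h4
      rw [or_self] at h2
      have h5 : ¬ 0 < (z - z').natAbs := fun hpos => hac _ (ε j).2.1 _ hpos h2
      have : z = z' := by omega
      rw [this]
    · obtain ⟨r, z, h⟩ := hleast a ha
      exact ⟨(ε.symm r, z), trivial, by simpa [Φ] using h⟩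
  refine ⟨Φ ∘ orbitEquiv _, hΦ.comp (orbitEquiv _).bijective.bijOn_univ, fun z => ?_⟩
  rw [Function.comp_apply, orbitEquiv_orbitSucc]
  simp only [Φ, Function.comp_apply]
  rw [add_comm, zpow_add, Equiv.Perm.mul_apply, zpow_one]
  rfl

/-! ### A model of `TK` from a sequence of colorings -/

namespace TK

/-- The `TK`-structure with given sorts and unary functions. -/
def mkStructure {M : Type*} (so : M → TKRel 1) (F : TKFun 1 → M → M) : TKLang.Structure M where
  funMap := fun {n} f v => match n, f, v with
    | 0, f, _ => nomatch f
    | 1, f, v => F f (v 0)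
    | _ + 2, f, _ => nomatch f
  RelMap := fun {n} R v => match n, R, v with
    | 0, R, _ => nomatch R
    | 1, R, v => so (v 0) = R
    | _ + 2, R, _ => nomatch R

/-- Isomorphism of `TK`-structures in terms of sorts and unary functions. -/
theorem nonempty_equiv_iff {M N : TKLang.Structure ℕ} :
    Nonempty (@FirstOrder.Language.Equiv TKLang ℕ ℕ M N) ↔ ∃ σ : Equiv.Perm ℕ,
      (∀ f a, σ (@app ℕ M f a) = @app ℕ N f (σ a)) ∧
      ∀ s a, σ a ∈ @sort ℕ N s ↔ a ∈ @sort ℕ M s := by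
  rw [_root_.nonempty_equiv_iff]
  have hv : ∀ (σ : Equiv.Perm ℕ) (v : Fin 1 → ℕ), σ ∘ v = ![σ (v 0)] ∧ v = ![v 0] := fun σ v => by
    constructor <;> ext i <;> rw [Subsingleton.elim i 0] <;> rfl
  refine exists_congr fun σ => and_congr ⟨fun h f a => ?_, fun h n f v => ?_⟩
    ⟨fun h s a => ?_, fun h n R v => ?_⟩
  · have := h 1 f ![a]
    rw [(hv σ ![a]).1] at this
    exact this
  · have key : ∀ f : TKFun 1, ∀ v : Fin 1 → ℕ,
        σ (M.funMap (n := 1) f v) = N.funMap (n := 1) f (σ ∘ v) := fun f v => by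
      rw [(hv σ v).1, (hv σ v).2]
      exact h f (v 0)
    cases f <;> exact key _ v
  · have := h 1 s ![a]
    rw [(hv σ ![a]).1] at this
    exact this
  · have key : ∀ s : TKRel 1, ∀ v : Fin 1 → ℕ,
        N.RelMap (n := 1) s (σ ∘ v) ↔ M.RelMap (n := 1) s v := fun s v => by
      rw [(hv σ v).1, (hv σ v).2]
      exact h s (v 0)
    cases R <;> exact key _ v

/-- The universe of the standard models: points of sort `U`, of the sorts `C i`, and of the sorts
`V i`. -/
abbrev Point : Type := ℕ ⊕ List Bool ⊕ List Bool × ℕ × ℕ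

/-- The sort of a point. -/
def pointSort : Point → TKRel 1
  | .inl _ => .U
  | .inr (.inl s) => .C s.length
  | .inr (.inr (s, _, _)) => .V s.length

/-- The functions of the standard model coded by a sequence of colorings `x`: over the point `s` of
the tree and the `n`-th point of `U`, there are `x n s` orbits, or infinitely many if
`x n s = 0`. -/
noncomputable def pointFun (x : ℕ → Coloring) : TKFun 1 → Point → Point
  -- The length tests make each symbol the identity off its domain sort, as the coding convention
  -- demands.
  | .S i, .inr (.inr (s, n, z)) =>
      .inr (.inr (s, n, if s.length = i then orbitSucc (x n s) z else z))
  | .pr0 i, .inr (.inr (s, n, z)) => if s.length = i then .inr (.inl s) else .inr (.inr (s, n, z))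
  | .pr1 i, .inr (.inr (s, n, z)) => if s.length = i then .inl n else .inr (.inr (s, n, z))
  | .tau i, .inr (.inl s) => .inr (.inl (if s.length = i + 1 then s.dropLast else s))
  | _, p => p

/-- A numbering of the points. -/
noncomputable def pointEquiv : Point ≃ ℕ := nonempty_equiv_of_countable.some

/-- The standard model coded by a sequence of colorings. -/
noncomputable def ofColorings (x : ℕ → Coloring) : TKLang.Structure ℕ :=
  mkStructure (fun a => pointSort (pointEquiv.symm a))
    fun f a => pointEquiv (pointFun x f (pointEquiv.symm a))

theorem app_ofColorings (x : ℕ → Coloring) (f : TKFun 1) (p : Point) :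
    @app ℕ (ofColorings x) f (pointEquiv p) = pointEquiv (pointFun x f p) :=
  congrArg (fun p => pointEquiv (pointFun x f p)) (pointEquiv.symm_apply_apply p)

theorem mem_sort_ofColorings (x : ℕ → Coloring) (s : TKRel 1) (p : Point) :
    pointEquiv p ∈ @sort ℕ (ofColorings x) s ↔ pointSort p = s := by
  change pointSort (pointEquiv.symm (pointEquiv p)) = s ↔ _
  rw [pointEquiv.symm_apply_apply]

theorem pointSort_eq_U {p : Point} : pointSort p = .U ↔ ∃ n, p = .inl n := by
  rcases p with n | s | ⟨s, n, z⟩ <;> simp [pointSort]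

theorem pointSort_eq_C {p : Point} {i : ℕ} :
    pointSort p = .C i ↔ ∃ s : List Bool, s.length = i ∧ p = .inr (.inl s) := by
  rcases p with n | s | ⟨s, n, z⟩ <;> simp [pointSort]

theorem pointSort_eq_V {p : Point} {i : ℕ} :
    pointSort p = .V i ↔ ∃ (s : List Bool) (n z : ℕ), s.length = i ∧ p = .inr (.inr (s, n, z)) := by
  rcases p with n | s | ⟨s, n, z⟩ <;> simp [pointSort]

theorem pointFun_S_iterate (x : ℕ → Coloring) (s : List Bool) (n z m : ℕ) :
    (pointFun x (.S s.length))^[m] (.inr (.inr (s, n, z))) =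
      .inr (.inr (s, n, (orbitSucc (x n s))^[m] z)) := by
  induction m with
  | zero => rfl
  | succ m ih => rw [Function.iterate_succ_apply', ih, Function.iterate_succ_apply']; simp [pointFun]

theorem ncard_length_eq (i : ℕ) : {s : List Bool | s.length = i}.ncard = 2 ^ i := by
  have : Nat.card (List.Vector Bool i) = 2 ^ i := by simp
  exact this

theorem dropLast_eq_iff {s t : List Bool} (h : t.length = s.length + 1) :
    t.dropLast = s ↔ t = s ++ [false] ∨ t = s ++ [true] := by
  constructor
  · rintro rfl
    have hne : t ≠ [] := by rintro rfl; simp at h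
    have := List.dropLast_append_getLast hne
    cases hb : t.getLast hne <;> rw [hb] at this
    · exact Or.inl this.symm
    · exact Or.inr this.symm
  · rintro (rfl | rfl) <;> simp

theorem ofColorings_mem (x : ℕ → Coloring) : ofColorings x ∈ TKMod := by
  have hsort := mem_sort_ofColorings x
  have happ := app_ofColorings x
  have hsurj := pointEquiv.surjective
  have hinj := pointEquiv.injective
  refine @IsModel.mk ℕ (ofColorings x) ?_ ?_ ?_ ?_ ?_ ?_ ?_ ?_ ?_ ?_ ?_ ?_ ?_
  · intro a
    obtain ⟨p, rfl⟩ := hsurj a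
    simp [hsort]
  · intro f a ha
    obtain ⟨p, rfl⟩ := hsurj a
    rw [hsort] at ha
    rw [happ, hsort]
    cases f
    · obtain ⟨s, n, z, hs, rfl⟩ := pointSort_eq_V.1 ha
      simp [pointFun, pointSort, cod, hs]
    · obtain ⟨s, n, z, hs, rfl⟩ := pointSort_eq_V.1 ha
      simp [pointFun, pointSort, cod, hs]
    · obtain ⟨s, n, z, hs, rfl⟩ := pointSort_eq_V.1 ha
      simp [pointFun, pointSort, cod, hs]
    · obtain ⟨s, hs, rfl⟩ := pointSort_eq_C.1 ha
      simp [pointFun, pointSort, cod, hs]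
  · intro f a ha
    obtain ⟨p, rfl⟩ := hsurj a
    rw [hsort] at ha
    rw [happ]
    congr 1
    cases f <;> rcases p with n | s | ⟨s, n, z⟩ <;> simp_all [pointFun, pointSort, dom]
  · exact Set.infinite_of_injective_forall_mem (f := fun n => pointEquiv (.inl n))
      (fun m n h => by simpa using h) fun n => (hsort _ _).2 rfl
  · refine fun i => Set.infinite_of_injective_forall_mem
      (f := fun n => pointEquiv (.inr (.inr (List.replicate i false, n, 0))))
      (fun m n h => by simpa using h) fun n => (hsort _ _).2 ?_
    simp [pointSort]
  · intro i
    have : @sort ℕ (ofColorings x) (.C i) =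
        (fun s => pointEquiv (.inr (.inl s))) '' {s : List Bool | s.length = i} := by
      ext a
      obtain ⟨p, rfl⟩ := hsurj a
      rw [hsort, pointSort_eq_C]
      simp [eq_comm]
    rw [this, Set.ncard_image_of_injective _ fun s t h => by simpa using h, ncard_length_eq]
  · intro i a ha
    obtain ⟨p, rfl⟩ := hsurj a
    obtain ⟨s, rfl, rfl⟩ := pointSort_eq_C.1 ((hsort _ _).1 ha)
    refine ⟨pointEquiv (.inr (.inl (s ++ [false]))), (hsort _ _).2 (by simp [pointSort]), ?_⟩
    rw [happ]
    simp [pointFun]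
  · intro i a ha
    obtain ⟨p, rfl⟩ := hsurj a
    obtain ⟨s, rfl, rfl⟩ := pointSort_eq_C.1 ((hsort _ _).1 ha)
    have : {d ∈ @sort ℕ (ofColorings x) (.C (s.length + 1)) |
        @app ℕ (ofColorings x) (.tau s.length) d = pointEquiv (.inr (.inl s))} =
        {pointEquiv (.inr (.inl (s ++ [false]))), pointEquiv (.inr (.inl (s ++ [true])))} := by
      ext d
      obtain ⟨q, rfl⟩ := hsurj d
      simp only [Set.mem_ofPred_eq, Set.mem_insert_iff, Set.mem_singleton_iff, hsort, happ,
        hinj.eq_iff, pointSort_eq_C]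
      constructor
      · rintro ⟨⟨t, ht, rfl⟩, h⟩
        simpa [pointFun, ht, dropLast_eq_iff ht] using h
      · rintro (rfl | rfl) <;> simp [pointFun]
    rw [this, Set.ncard_pair]
    simp
  · intro i a ha b hb
    obtain ⟨p, rfl⟩ := hsurj a
    obtain ⟨q, rfl⟩ := hsurj b
    obtain ⟨s, rfl, rfl⟩ := pointSort_eq_C.1 ((hsort _ _).1 ha)
    obtain ⟨n, rfl⟩ := pointSort_eq_U.1 ((hsort _ _).1 hb)
    refine ⟨pointEquiv (.inr (.inr (s, n, 0))), (hsort _ _).2 rfl, ?_, ?_⟩ <;>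
      simp [happ, pointFun]
  · intro i
    refine ⟨fun a ha => ?_, fun a ha b hb h => ?_, fun a ha => ?_⟩
    · obtain ⟨p, rfl⟩ := hsurj a
      obtain ⟨s, n, z, rfl, rfl⟩ := pointSort_eq_V.1 ((hsort _ _).1 ha)
      rw [happ, hsort]
      rfl
    · obtain ⟨p, rfl⟩ := hsurj a
      obtain ⟨q, rfl⟩ := hsurj b
      obtain ⟨s, n, z, hs, rfl⟩ := pointSort_eq_V.1 ((hsort _ _).1 ha)
      obtain ⟨t, m, w, ht, rfl⟩ := pointSort_eq_V.1 ((hsort _ _).1 hb)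
      rw [happ, happ, hinj.eq_iff] at h
      simp only [pointFun, hs, ht, if_true, Sum.inr.injEq, Prod.mk.injEq] at h
      obtain ⟨rfl, rfl, h⟩ := h
      rw [(orbitSucc _).injective h]
    · obtain ⟨p, rfl⟩ := hsurj a
      obtain ⟨s, n, z, rfl, rfl⟩ := pointSort_eq_V.1 ((hsort _ _).1 ha)
      refine ⟨pointEquiv (.inr (.inr (s, n, (orbitSucc (x n s)).symm z))), (hsort _ _).2 rfl, ?_⟩
      rw [happ]
      simp [pointFun]
  · intro i a ha m hm h
    obtain ⟨p, rfl⟩ := hsurj a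
    obtain ⟨s, n, z, rfl, rfl⟩ := pointSort_eq_V.1 ((hsort _ _).1 ha)
    have hsemi : Function.Semiconj pointEquiv (pointFun x (.S s.length))
        (@app ℕ (ofColorings x) (.S s.length)) := fun p => (happ _ p).symm
    rw [← (hsemi.iterate_right m) _, pointFun_S_iterate, hinj.eq_iff] at h
    simp only [Sum.inr.injEq, Prod.mk.injEq, true_and] at h
    exact orbitSucc_iterate_ne _ _ hm h
  · intro i a ha
    obtain ⟨p, rfl⟩ := hsurj a
    obtain ⟨s, n, z, rfl, rfl⟩ := pointSort_eq_V.1 ((hsort _ _).1 ha)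
    simp [happ, pointFun]
  · intro i a ha
    obtain ⟨p, rfl⟩ := hsurj a
    obtain ⟨s, n, z, rfl, rfl⟩ := pointSort_eq_V.1 ((hsort _ _).1 ha)
    simp [happ, pointFun]

/-- Only `S` depends on the colorings, and at a given point only through the single value `x n s`.
-/
theorem continuous_pointFun (f : TKFun 1) (p : Point) :
    Continuous fun x : ℕ → Coloring => pointEquiv (pointFun x f p) := by
  cases f <;> rcases p with n | s | ⟨s, n, z⟩ <;> simp only [pointFun] <;>
    try exact continuous_const
  exact (continuous_of_discreteTopology
    (f := fun k => pointEquiv (.inr (.inr (s, n, if s.length = _ then orbitSucc k z else z))))).comp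
    (continuous_apply_apply n s)

theorem continuous_ofColorings : Continuous ofColorings := by
  refine continuous_generateFrom_iff.2 ?_
  rintro A (⟨n, f, v, k, rfl⟩ | ⟨n, R, v, h⟩)
  · have : Continuous fun x => (ofColorings x).funMap f v := by
      match n, f, v with
      | 1, f, v => exact continuous_pointFun f (pointEquiv.symm (v 0))
    exact (isOpen_discrete {k}).preimage this
  · have : ∃ P : Prop, ∀ x, (ofColorings x).RelMap R v ↔ P := by
      match n, R, v with
      | 1, R, v => exact ⟨pointSort (pointEquiv.symm (v 0)) = R, fun x => Iff.rfl⟩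
    obtain ⟨P, hP⟩ := this
    rcases h with rfl | rfl <;> simp only [Set.preimage_ofPred_eq, hP] <;> exact isOpen_const

/-- Commuting with the projections, an isomorphism sends `(s, n, z)` to `(g s, σ n, ζ s n z)`.
Commuting with `tau` makes `g` a tree automorphism, and commuting with `S` makes `ζ s n` a
conjugacy, which forces equal numbers of orbits. Conversely, when the numbers agree, the last
coordinate can be left fixed. -/
theorem ofColorings_equiv_iff (x y : ℕ → Coloring) :
    Nonempty (@FirstOrder.Language.Equiv TKLang ℕ ℕ (ofColorings x) (ofColorings y)) ↔
      ColoringEquiv x y := by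
  rw [nonempty_equiv_iff, coloringEquiv_iff]
  constructor
  · rintro ⟨ψ, hf, hs⟩
    let φ : Equiv.Perm Point := (pointEquiv.trans ψ).trans pointEquiv.symm
    have hφ : ∀ p, ψ (pointEquiv p) = pointEquiv (φ p) := fun p => by simp [φ]
    have hsort : ∀ p, pointSort (φ p) = pointSort p := fun p => by
      have := hs (pointSort p) (pointEquiv p)
      rw [hφ, mem_sort_ofColorings, mem_sort_ofColorings] at this
      exact this.2 rfl
    have hfun : ∀ f p, φ (pointFun x f p) = pointFun y f (φ p) := fun f p => by
      have := hf f (pointEquiv p)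
      rwa [app_ofColorings, hφ, hφ, app_ofColorings, pointEquiv.injective.eq_iff] at this
    have hsort' : ∀ p, pointSort (φ.symm p) = pointSort p := fun p => by
      rw [← hsort, φ.apply_symm_apply]
    have hU : ∀ n, ∃ m, φ (.inl n) = .inl m := fun n => pointSort_eq_U.1 (hsort _)
    have hC : ∀ s, ∃ t : List Bool, t.length = s.length ∧ φ (.inr (.inl s)) = .inr (.inl t) :=
      fun s => pointSort_eq_C.1 (hsort _)
    choose σ hσ using hU
    choose g hg hg' using hC
    have hV : ∀ s n z, ∃ w, φ (.inr (.inr (s, n, z))) = .inr (.inr (g s, σ n, w)) := by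
      intro s n z
      obtain ⟨t, m, w, ht, h⟩ := pointSort_eq_V.1 (hsort (.inr (.inr (s, n, z))))
      have h0 := hfun (.pr0 s.length) (.inr (.inr (s, n, z)))
      have h1 := hfun (.pr1 s.length) (.inr (.inr (s, n, z)))
      simp only [h, pointFun, ht, if_true, hg', hσ, Sum.inr.injEq, Sum.inl.injEq] at h0 h1
      exact ⟨w, by rw [h, h0, h1]⟩
    choose ζ hζ using hV
    have hσb : Function.Bijective σ := by
      refine ⟨fun m n h => ?_, fun m => ?_⟩
      · have := (hσ m).trans ((congrArg _ h).trans (hσ n).symm)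
        simpa using this
      · obtain ⟨n, hn⟩ := pointSort_eq_U.1 (hsort' (.inl m))
        exact ⟨n, by rw [Equiv.symm_apply_eq, hσ] at hn; simpa using hn.symm⟩
    have hgb : Function.Bijective g := by
      refine ⟨fun s t h => ?_, fun t => ?_⟩
      · have := (hg' s).trans ((congrArg (fun s => Sum.inr (Sum.inl s)) h).trans (hg' t).symm)
        simpa using this
      · obtain ⟨s, -, hs⟩ := pointSort_eq_C.1 (hsort' (.inr (.inl t)))
        exact ⟨s, by rw [Equiv.symm_apply_eq, hg'] at hs; simpa using hs.symm⟩
    have hζb : ∀ s n, Function.Bijective (ζ s n) := by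
      refine fun s n => ⟨fun z w h => ?_, fun w => ?_⟩
      · have := (hζ s n z).trans (h ▸ (hζ s n w).symm)
        simpa using this
      · obtain ⟨t, m, z, -, hz⟩ := pointSort_eq_V.1 (hsort' (.inr (.inr (g s, σ n, w))))
        rw [Equiv.symm_apply_eq, hζ] at hz
        simp only [Sum.inr.injEq, Prod.mk.injEq, hgb.1.eq_iff, hσb.1.eq_iff] at hz
        obtain ⟨rfl, rfl, hz⟩ := hz
        exact ⟨z, hz.symm⟩
    refine ⟨TreeAut.ofEquiv (Equiv.ofBijective g hgb) fun s => ?_, Equiv.ofBijective σ hσb,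
      fun n s => (eq_of_orbitSucc_conj (Equiv.ofBijective _ (hζb s n)) fun z => ?_).symm⟩
    · change g s.dropLast = (g s).dropLast
      rcases s.eq_nil_or_concat with rfl | ⟨t, b, rfl⟩
      · have := hg []
        simp only [List.length_nil, List.length_eq_zero_iff] at this
        simp [this]
      · have := hfun (.tau t.length) (.inr (.inl (t ++ [b])))
        simp only [pointFun, hg', hg, List.length_append, List.length_singleton, if_true,
          Sum.inr.injEq, Sum.inl.injEq] at this
        rw [List.concat_eq_append]
        exact this
    · have := hfun (.S s.length) (.inr (.inr (s, n, z)))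
      simp only [pointFun, hζ, hg, if_true, Sum.inr.injEq, Prod.mk.injEq, true_and] at this
      exact this
  · rintro ⟨g, σ, h⟩
    let φ : Equiv.Perm Point :=
      σ.sumCongr (g.toEquiv.sumCongr (g.toEquiv.prodCongr (σ.prodCongr (Equiv.refl _))))
    refine ⟨(pointEquiv.symm.trans φ).trans pointEquiv, fun f a => ?_, fun s a => ?_⟩
    · obtain ⟨p, rfl⟩ := pointEquiv.surjective a
      simp only [Equiv.trans_apply, app_ofColorings, Equiv.symm_apply_apply]
      congr 1
      cases f <;> rcases p with n | s | ⟨s, n, z⟩ <;>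
        simp [φ, pointFun, TreeAut.length_apply, h] <;> split_ifs <;>
        simp [TreeAut.apply_dropLast]
    · obtain ⟨p, rfl⟩ := pointEquiv.surjective a
      simp only [Equiv.trans_apply, mem_sort_ofColorings, Equiv.symm_apply_apply]
      rcases p with n | s | ⟨s, n, z⟩ <;> simp [φ, pointSort, TreeAut.length_apply]

end TK

theorem coloringEquiv_borelReducible_isoOn_TKMod : BorelReducible ColoringEquiv (IsoOn TKMod) :=
  BorelReducible.of_measurable
    (f := fun x => (⟨TK.ofColorings x, TK.ofColorings_mem x⟩ : TKMod))
    (TK.continuous_ofColorings.subtype_mk _).measurable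
    fun x y => (TK.ofColorings_equiv_iff x y).symm

/-! ### Measurability of natural numbers defined from a structure -/

theorem Measurable.apply_countable {Ω α β : Type*} [MeasurableSpace Ω] [MeasurableSpace α]
    [MeasurableSpace β] [Countable α] [MeasurableSingletonClass α] {F : Ω → α → β} {a : Ω → α}
    (hF : ∀ i, Measurable fun ω => F ω i) (ha : Measurable a) : Measurable fun ω => F ω (a ω) :=
  (measurable_from_prod_countable_left (f := fun p : Ω × α => F p.1 p.2) hF).comp
    (measurable_id.prodMk ha)

theorem Measurable.eq_nat {Ω : Type*} [MeasurableSpace Ω] {a b : Ω → ℕ} (ha : Measurable a)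
    (hb : Measurable b) : Measurable fun ω => a ω = b ω :=
  measurableSet_setOfPred.1 (measurableSet_eq_fun ha hb)

theorem Measurable.lt_nat {Ω : Type*} [MeasurableSpace Ω] {a b : Ω → ℕ} (ha : Measurable a)
    (hb : Measurable b) : Measurable fun ω => a ω < b ω :=
  measurableSet_setOfPred.1 (measurableSet_lt ha hb)

theorem Measurable.sInf_nat {Ω : Type*} [MeasurableSpace Ω] {A : Ω → Set ℕ}
    (hA : ∀ a, Measurable fun ω => a ∈ A ω) : Measurable fun ω => sInf (A ω) := by
  refine measurable_to_countable' fun k => ?_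
  -- The second alternative accounts for the default value `sInf ∅ = 0`.
  have : (fun ω => sInf (A ω)) ⁻¹' {k} =
      {ω | (k ∈ A ω ∧ ∀ j, j < k → j ∉ A ω) ∨ (k = 0 ∧ ∀ j, j ∉ A ω)} := by
    ext ω
    simp only [Set.mem_preimage, Set.mem_singleton_iff, Set.mem_ofPred_eq]
    constructor
    · rintro rfl
      rcases (A ω).eq_empty_or_nonempty with h | h
      · exact Or.inr (by simp [h])
      · exact Or.inl ⟨Nat.sInf_mem h, fun j hj => Nat.notMem_of_lt_sInf hj⟩
    · rintro (⟨h, h'⟩ | ⟨rfl, h⟩)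
      · exact le_antisymm (Nat.sInf_le h) (le_of_not_gt fun hlt => h' _ hlt (Nat.sInf_mem ⟨k, h⟩))
      · rw [Set.eq_empty_of_forall_notMem h, Nat.sInf_empty]
  rw [this, measurableSet_setOfPred]
  have := hA
  fun_prop

theorem Measurable.ncard_nat {Ω : Type*} [MeasurableSpace Ω] {A : Ω → Set ℕ}
    (hA : ∀ a, Measurable fun ω => a ∈ A ω) : Measurable fun ω => (A ω).ncard := by
  refine measurable_to_countable' fun k => ?_
  -- There are only countably many finite sets of natural numbers; the second alternative accounts
  -- for infinite sets, whose `ncard` is 0.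
  have : (fun ω => (A ω).ncard) ⁻¹' {k} =
      {ω | (∃ F : Finset ℕ, F.card = k ∧ ∀ a, a ∈ A ω ↔ a ∈ F) ∨
        (k = 0 ∧ ∀ F : Finset ℕ, ¬ ∀ a, a ∈ A ω ↔ a ∈ F)} := by
    ext ω
    simp only [Set.mem_preimage, Set.mem_singleton_iff, Set.mem_ofPred_eq]
    constructor
    · rintro rfl
      rcases (A ω).finite_or_infinite with h | h
      · exact Or.inl ⟨h.toFinset, (Set.ncard_eq_toFinset_card _ h).symm, by simp⟩
      · refine Or.inr ⟨h.ncard, fun F hF => h ?_⟩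
        rw [show A ω = F from Set.ext hF]
        exact F.finite_toSet
    · rintro (⟨F, rfl, hF⟩ | ⟨rfl, h⟩)
      · rw [show A ω = F from Set.ext hF, Set.ncard_coe_finset]
      · refine Set.Infinite.ncard fun hfin => h hfin.toFinset (by simp)
  rw [this, measurableSet_setOfPred]
  have := hA
  fun_prop

namespace TK

/-! ### A sequence of colorings from a model of `TK` -/

/-- For a set of two natural numbers, the smaller or the larger one. -/
noncomputable def pick (K : Set ℕ) (b : Bool) : ℕ := sInf {d | d ∈ K ∧ (b = true → sInf K < d)}

theorem pick_spec {K : Set ℕ} (hK : K.ncard = 2) :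
    (∀ d, d ∈ K ↔ ∃ b, d = pick K b) ∧ Function.Injective (pick K) := by
  obtain ⟨a, b, hab, rfl⟩ : ∃ a b, a < b ∧ K = {a, b} := by
    obtain ⟨a, b, hab, rfl⟩ := Set.ncard_eq_two.1 hK
    rcases hab.lt_or_gt with h | h
    · exact ⟨a, b, h, rfl⟩
    · exact ⟨b, a, h, Set.pair_comm a b⟩
  have h0 : sInf ({a, b} : Set ℕ) = a :=
    IsLeast.csInf_eq ⟨Set.mem_insert _ _, by rintro x (rfl | rfl); exacts [le_rfl, hab.le]⟩
  have h1 : pick {a, b} false = a :=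
    IsLeast.csInf_eq ⟨by simp, by rintro x ⟨rfl | rfl, -⟩; exacts [le_rfl, hab.le]⟩
  have h2 : pick {a, b} true = b :=
    IsLeast.csInf_eq ⟨by simp [h0, hab], by
      rintro x ⟨rfl | rfl, h⟩
      · simp [h0] at h
      · exact le_rfl⟩
  refine ⟨fun d => by simp [h1, h2], fun c d h => ?_⟩
  cases c <;> cases d <;> simp_all

/-- The successors of a point of a sort `C i`. -/
def children (M : TKLang.Structure ℕ) (i c : ℕ) : Set ℕ :=
  {d | d ∈ @sort ℕ M (.C (i + 1)) ∧ @app ℕ M (.tau i) d = c}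

/-- The point of the tree of a model that corresponds to a binary sequence, in reverse order. -/
noncomputable def nodeRev (M : TKLang.Structure ℕ) : List Bool → ℕ
  | [] => sInf (@sort ℕ M (.C 0))
  -- Recursion on lists strips the head, which is therefore the deepest bit.
  | b :: s => pick (children M s.length (nodeRev M s)) b

/-- The point of the tree of a model that corresponds to a binary sequence. -/
noncomputable def node (M : TKLang.Structure ℕ) (s : List Bool) : ℕ := nodeRev M s.reverse

/-- An enumeration of the sort `U`. -/
noncomputable def enumU (M : TKLang.Structure ℕ) (n : ℕ) : ℕ := Nat.nth (· ∈ @sort ℕ M .U) n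

/-- The set of points over a given point of the tree and a given point of `U`. -/
def fiber (M : TKLang.Structure ℕ) (n : ℕ) (s : List Bool) : Set ℕ :=
  {a | a ∈ @sort ℕ M (.V s.length) ∧ @app ℕ M (.pr0 s.length) a = node M s ∧
    @app ℕ M (.pr1 s.length) a = enumU M n}

/-- The colorings of the tree of a model that are given by the numbers of orbits, where `0` stands
for infinitely many orbits. -/
noncomputable def toColorings (M : TKLang.Structure ℕ) (n : ℕ) : Coloring := fun s =>
  (orbitReps (@app ℕ M (.S s.length)) (fiber M n s)).ncard

theorem measurable_mem_sort (s : TKRel 1) (a : ℕ) :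
    Measurable fun M : TKLang.Structure ℕ => a ∈ @sort ℕ M s :=
  measurable_relMap (L := TKLang) (n := 1) s ![a]

theorem measurable_app (f : TKFun 1) {a : TKLang.Structure ℕ → ℕ} (ha : Measurable a) :
    Measurable fun M : TKLang.Structure ℕ => @app ℕ M f (a M) :=
  Measurable.apply_countable (F := fun M a => @app ℕ M f a)
    (fun i => measurable_funMap (L := TKLang) (n := 1) f ![i]) ha

theorem measurable_node (s : List Bool) : Measurable fun M => node M s := by
  have key : ∀ s, Measurable fun M => nodeRev M s := fun s => by
    induction s with
    | nil => exact Measurable.sInf_nat fun a => measurable_mem_sort _ a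
    | cons b s ih =>
      have h : ∀ a, Measurable fun M => a ∈ children M s.length (nodeRev M s) := fun a =>
        (measurable_mem_sort _ a).and ((measurable_app _ measurable_const).eq_nat ih)
      exact Measurable.sInf_nat fun a => (h a).and
        (measurable_const.imp ((Measurable.sInf_nat h).lt_nat measurable_const))
  exact key _

theorem measurable_enumU (n : ℕ) : Measurable fun M => enumU M n := by
  induction n using Nat.strong_induction_on with
  | _ n ih =>
    simp only [enumU] at ih ⊢
    -- The `n`-th element is the least one above all earlier ones, so measurability passes up by
    -- strong induction.
    simp_rw [Nat.nth_eq_sInf _ n]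
    refine Measurable.sInf_nat fun a => (measurable_mem_sort _ a).and ?_
    refine Measurable.forall fun k => ?_
    by_cases hk : k < n
    · simpa only [hk, forall_const] using (ih k hk).lt_nat measurable_const
    · simpa only [hk, IsEmpty.forall_iff] using measurable_const

theorem measurable_toColorings : Measurable toColorings := by
  refine measurable_pi_lambda _ fun n => measurable_pi_lambda _ fun s => ?_
  have hfib : ∀ a, Measurable fun M => a ∈ fiber M n s := fun a =>
    (measurable_mem_sort _ a).and (((measurable_app _ measurable_const).eq_nat
      (measurable_node s)).and ((measurable_app _ measurable_const).eq_nat (measurable_enumU n)))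
  have hit : ∀ a m, Measurable fun M => (@app ℕ M (.S s.length))^[m] a := fun a m => by
    induction m with
    | zero => exact measurable_const
    | succ m ih =>
      simp_rw [Function.iterate_succ_apply']
      exact measurable_app _ ih
  refine Measurable.ncard_nat fun a => (hfib a).and (Measurable.forall fun b =>
    (hfib b).imp (Measurable.forall fun m => Measurable.imp (Measurable.or ?_ ?_) measurable_const))
  · exact (hit a m).eq_nat measurable_const
  · exact (hit b m).eq_nat measurable_const

/-! ### Recovering a model of TK from its colorings -/

section Model

variable {M : TKLang.Structure ℕ}

theorem node_append (s : List Bool) (b : Bool) :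
    node M (s ++ [b]) = pick (children M s.length (node M s)) b := by
  simp [node, nodeRev]

/-- Level `i + 1` is the disjoint union of the fibers of `tau i` over level `i`, each consisting of
the two points enumerated by `pick`. -/
theorem node_spec (hM : @IsModel ℕ M) (i : ℕ) :
    Set.BijOn (node M) {s | s.length = i} (@sort ℕ M (.C i)) := by
  induction i with
  | zero =>
    obtain ⟨c, hc⟩ := Set.ncard_eq_one.1 (hM.card_C 0)
    have : node M [] = c := by simp [node, nodeRev, hc]
    rw [hc, show {s : List Bool | s.length = 0} = {[]} by ext; simp, Set.bijOn_singleton, this]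
  | succ i ih =>
    have hch : ∀ s : List Bool, s.length = i → (children M i (node M s)).ncard = 2 := fun s hs =>
      hM.tau_fiber i _ (ih.mapsTo hs)
    have hform : ∀ s : List Bool, s.length = i + 1 → ∃ t b, t.length = i ∧ s = t ++ [b] :=
      fun s hs => by
        rcases s.eq_nil_or_concat with rfl | ⟨t, b, rfl⟩
        · simp at hs
        · exact ⟨t, b, by simpa using hs, by simp⟩
    have hmem : ∀ s b, s.length = i → node M (s ++ [b]) ∈ children M i (node M s) :=
      fun s b hs => by
        rw [node_append, hs]
        exact ((pick_spec (hch s hs)).1 _).2 ⟨b, rfl⟩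
    refine ⟨fun s hs => ?_, fun s hs t ht h => ?_, fun c hc => ?_⟩
    · replace hs : s.length = i + 1 := hs
      obtain ⟨s, b, hs', rfl⟩ := hform s hs
      exact (hmem s b hs').1
    · replace hs : s.length = i + 1 := hs
      replace ht : t.length = i + 1 := ht
      obtain ⟨s, b, hs', rfl⟩ := hform s hs
      obtain ⟨t, c, ht', rfl⟩ := hform t ht
      have hst : s = t := ih.injOn hs' ht' <| by
        rw [← (hmem s b hs').2, ← (hmem t c ht').2, h]
      subst hst
      rw [node_append, node_append, hs'] at h
      rw [(pick_spec (hch s hs')).2 h]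
    · obtain ⟨s, hs, hsc⟩ := ih.surjOn (hM.mapsTo (.tau i) hc)
      obtain ⟨b, hb⟩ := ((pick_spec (hch s hs)).1 c).1 ⟨hc, hsc.symm⟩
      have hs' : s.length = i := hs
      refine ⟨s ++ [b], by simp [hs'], ?_⟩
      rw [node_append, hs', hb]

theorem tau_node (hM : @IsModel ℕ M) {s : List Bool} {i : ℕ} (hs : s.length = i + 1) :
    @app ℕ M (.tau i) (node M s) = node M s.dropLast := by
  rcases s.eq_nil_or_concat with rfl | ⟨t, b, rfl⟩
  · simp at hs
  · have ht : t.length = i := by simpa using hs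
    subst ht
    rw [List.concat_eq_append, List.dropLast_concat, node_append]
    exact (((pick_spec (hM.tau_fiber _ _ ((node_spec hM _).mapsTo rfl))).1 _).2 ⟨b, rfl⟩).2

theorem enumU_spec (hM : @IsModel ℕ M) : Set.BijOn (enumU M) Set.univ (@sort ℕ M .U) :=
  ⟨fun n _ => Nat.nth_mem_of_infinite (p := (· ∈ @sort ℕ M .U)) hM.infinite_U n,
    (Nat.nth_injective (p := (· ∈ @sort ℕ M .U)) hM.infinite_U).injOn, fun a ha => by
      have := Nat.range_nth_of_infinite (p := (· ∈ @sort ℕ M .U)) hM.infinite_U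
      obtain ⟨n, hn⟩ := this.ge ha
      exact ⟨n, trivial, hn⟩⟩

/-- `S` preserves both projections, so it restricts to a bijection of each fiber; the fiber is
nonempty and `S` has no cycles, hence the number of orbits determines the restriction. -/
theorem exists_bijOn_fiber (hM : @IsModel ℕ M) (n : ℕ) (s : List Bool) :
    ∃ e : ℕ → ℕ, Set.BijOn e Set.univ (fiber M n s) ∧
      ∀ z, e (orbitSucc (toColorings M n s) z) = @app ℕ M (.S s.length) (e z) := by
  refine exists_bijOn_orbitSucc ?_ ⟨fun a ha => ⟨(hM.S_bij _).mapsTo ha.1, ?_, ?_⟩,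
    (hM.S_bij _).injOn.mono fun a ha => ha.1, fun a ha => ?_⟩ fun a ha => hM.S_acyclic _ a ha.1
  · exact hM.fiber_nonempty _ _ ((node_spec hM _).mapsTo rfl) _ ((enumU_spec hM).mapsTo trivial)
  · rw [hM.pr0_S _ _ ha.1, ha.2.1]
  · rw [hM.pr1_S _ _ ha.1, ha.2.2]
  · obtain ⟨b, hb, rfl⟩ := (hM.S_bij _).surjOn ha.1
    exact ⟨b, ⟨hb, by rw [← hM.pr0_S _ _ hb, ha.2.1], by rw [← hM.pr1_S _ _ hb, ha.2.2]⟩, rfl⟩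

/-- The enumerations of the tree, of U and of every fiber glue to one bijection, because each point
of a sort `V i` lies in exactly one fiber. -/
theorem ofColorings_toColorings_equiv (hM : @IsModel ℕ M) :
    Nonempty (@FirstOrder.Language.Equiv TKLang ℕ ℕ (ofColorings (toColorings M)) M) := by
  have hso : ∀ {a s t}, a ∈ @sort ℕ M s → a ∈ @sort ℕ M t → s = t := fun hs ht =>
    (hM.exists_unique_sort _).unique hs ht
  choose e he heS using exists_bijOn_fiber hM
  let Φ : Point → ℕ
    | .inl n => enumU M n
    | .inr (.inl s) => node M s
    | .inr (.inr (s, n, z)) => e n s z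
  have hnode : ∀ s : List Bool, node M s ∈ @sort ℕ M (.C s.length) := fun s =>
    (node_spec hM _).mapsTo rfl
  have hfib : ∀ s n z, e n s z ∈ fiber M n s := fun s n z => (he n s).mapsTo trivial
  have hsort : ∀ p, Φ p ∈ @sort ℕ M (pointSort p) := by
    rintro (n | s | ⟨s, n, z⟩)
    · exact (enumU_spec hM).mapsTo trivial
    · exact hnode s
    · exact (hfib s n z).1
  have hnode_inj : Function.Injective (node M) := fun s t h => by
    have h1 := hso (hnode s) (h ▸ hnode t)
    simp only [TKRel.C.injEq] at h1
    exact (node_spec hM t.length).injOn h1 rfl h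
  have hΦ : Function.Bijective Φ := by
    constructor
    · intro p q h
      have h1 : pointSort p = pointSort q := hso (hsort p) (h ▸ hsort q)
      rcases p with n | s | ⟨s, n, z⟩ <;> rcases q with m | t | ⟨t, m, w⟩ <;>
        simp only [pointSort, reduceCtorEq, TKRel.C.injEq, TKRel.V.injEq] at h1
      · rw [(enumU_spec hM).injOn trivial trivial h]
      · rw [hnode_inj h]
      · have h2 := hfib s n z
        have h3 := hfib t m w
        change e n s z = e m t w at h
        rw [← h] at h3
        obtain rfl : s = t := hnode_inj (by rw [← h2.2.1, ← h3.2.1, h1])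
        obtain rfl : n = m := (enumU_spec hM).injOn trivial trivial (by rw [← h2.2.2, ← h3.2.2])
        rw [(he n s).injOn trivial trivial h]
    · intro a
      obtain ⟨s, ha, -⟩ := hM.exists_unique_sort a
      cases s with
      | U =>
        obtain ⟨n, -, hn⟩ := (enumU_spec hM).surjOn ha
        exact ⟨.inl n, hn⟩
      | C i =>
        obtain ⟨s, -, hs⟩ := (node_spec hM i).surjOn ha
        exact ⟨.inr (.inl s), hs⟩
      | V i =>
        obtain ⟨s, hs, hs'⟩ := (node_spec hM i).surjOn (hM.mapsTo (.pr0 i) ha)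
        obtain ⟨n, -, hn⟩ := (enumU_spec hM).surjOn (hM.mapsTo (.pr1 i) ha)
        have hs : s.length = i := hs
        subst hs
        obtain ⟨z, -, hz⟩ := (he n s).surjOn ⟨ha, hs'.symm, hn.symm⟩
        exact ⟨.inr (.inr (s, n, z)), hz⟩
  have hfun : ∀ f p, Φ (pointFun (toColorings M) f p) = @app ℕ M f (Φ p) := by
    intro f p
    by_cases hp : pointSort p = dom f
    · cases f
      · obtain ⟨s, n, z, rfl, rfl⟩ := pointSort_eq_V.1 hp
        simp [Φ, pointFun, heS]
      · obtain ⟨s, n, z, rfl, rfl⟩ := pointSort_eq_V.1 hp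
        simp [Φ, pointFun, (hfib s n z).2.1]
      · obtain ⟨s, n, z, rfl, rfl⟩ := pointSort_eq_V.1 hp
        simp [Φ, pointFun, (hfib s n z).2.2]
      · obtain ⟨s, hs, rfl⟩ := pointSort_eq_C.1 hp
        simp [Φ, pointFun, hs, tau_node hM hs]
    -- Off the domain sort, both functions are the identity.
    · rw [hM.off_dom f _ fun h => hp (hso (hsort p) h)]
      congr 1
      cases f <;> rcases p with n | s | ⟨s, n, z⟩ <;> simp_all [pointFun, pointSort, dom]
  rw [nonempty_equiv_iff]
  refine ⟨pointEquiv.symm.trans (Equiv.ofBijective Φ hΦ), fun f a => ?_, fun s a => ?_⟩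
  · obtain ⟨p, rfl⟩ := pointEquiv.surjective a
    simp [app_ofColorings, hfun]
  · obtain ⟨p, rfl⟩ := pointEquiv.surjective a
    rw [mem_sort_ofColorings]
    simp only [Equiv.trans_apply, Equiv.symm_apply_apply, Equiv.ofBijective_apply]
    exact ⟨fun h => hso (hsort p) h, fun h => h ▸ hsort p⟩

end Model

end TK

/-! ### Assembling the reductions -/

theorem nonempty_equiv_trans {L : FirstOrder.Language} {M N P : L.Structure ℕ}
    (h : Nonempty (@FirstOrder.Language.Equiv L ℕ ℕ M N))
    (h' : Nonempty (@FirstOrder.Language.Equiv L ℕ ℕ N P)) :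
    Nonempty (@FirstOrder.Language.Equiv L ℕ ℕ M P) :=
  h.elim fun e => h'.elim fun e' => ⟨@FirstOrder.Language.Equiv.comp L ℕ ℕ M N ℕ P e' e⟩

theorem nonempty_equiv_symm {L : FirstOrder.Language} {M N : L.Structure ℕ}
    (h : Nonempty (@FirstOrder.Language.Equiv L ℕ ℕ M N)) :
    Nonempty (@FirstOrder.Language.Equiv L ℕ ℕ N M) :=
  h.elim fun e => ⟨@FirstOrder.Language.Equiv.symm L ℕ ℕ M N e⟩

/-- A model is isomorphic to the standard model of its colorings, so two models are isomorphic
exactly when those standard models are. -/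
theorem isoOn_TKMod_borelReducible_coloringEquiv : BorelReducible (IsoOn TKMod) ColoringEquiv := by
  refine BorelReducible.of_measurable (f := fun M : TKMod => TK.toColorings M.1)
    (TK.measurable_toColorings.comp measurable_subtype_coe) fun M N => ?_
  rw [← TK.ofColorings_equiv_iff]
  have hM := TK.ofColorings_toColorings_equiv M.2
  have hN := TK.ofColorings_toColorings_equiv N.2
  exact ⟨fun h => nonempty_equiv_trans (nonempty_equiv_trans hM h) (nonempty_equiv_symm hN),
    fun h => nonempty_equiv_trans (nonempty_equiv_trans (nonempty_equiv_symm hM) h) hN⟩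

theorem countable_graph_symbols : Countable FirstOrder.Language.graph.Symbols := by
  have : ∀ n, Countable (FirstOrder.Language.graph.Relations n) := fun n => inferInstance
  have : ∀ n, IsEmpty (FirstOrder.Language.graph.Functions n) := fun n => inferInstance
  infer_instance

theorem mainTheorem4 :
    BorelReducible (IsoOn GraphMod) ColoringEquiv ∧
    BorelBireducible (IsoOn TKMod) ColoringEquiv ∧
    BorelComplete TKMod := by
  have := countable_graph_symbols
  exact ⟨isoOn_borelReducible_coloringEquiv _,
    ⟨isoOn_TKMod_borelReducible_coloringEquiv, coloringEquiv_borelReducible_isoOn_TKMod⟩,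
    fun L' _ Ψ => (isoOn_borelReducible_coloringEquiv (InfMod Ψ)).trans
      coloringEquiv_borelReducible_isoOn_TKMod⟩
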